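/- Let $M$ and $B$ be compact even-dimensional Riemannian manifolds without boundary, and write $C^\infty(M)$, $C^\infty(B)$ for the smooth complex-valued functions and $\mathcal X(M)$, $\mathcal X(B)$ for the smooth complex vector fields. Let $\pi:M\to B$ be a smooth surjective map which is a Riemannian submersion: its differential $d\pi:\mathcal X(M)\to \mathcal X(B)\otimes_{C^\infty(B)}C^\infty(M)$ is surjective and restricts to an isometric isomorphism on $\mathcal X_H(M):=(\ker d\pi)^\perp$; put $\mathcal X_V(M):=\ker d\pi$. Let $\mathrm{Cl}(M)$ be the complex Clifford algebra over $C^\infty(M)$ generated by $\mathcal X(M)$ with relations $XY+YX=2\langle X,Y\rangle$ ($\langle\cdot,\cdot\rangle$ the complex bilinear extension of the metric), graded so that vector fields are odd and with the conjugate-linear involution $X^*=\overline X$; let $\mathrm{Cl}_H(M),\mathrm{Cl}_V(M)\subset\mathrm{Cl}(M)$ be the subalgebras generated by $\mathcal X_H(M)$ and $\mathcal X_V(M)$. A spinor module for such a Clifford algebra is a finitely generated projective module $\mathcal E$ with a grading operator $\gamma$ ($\gamma^2=1$, $\gamma^*=\gamma$), a positive hermitian form identifying $\mathcal E$ with its (conjugate)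 dual, and an isomorphism of $\mathbb Z/2$-graded $*$-algebras $c$ from the Clifford algebra onto $\mathrm{End}(\mathcal E)$, where $\mathrm{End}(\mathcal E)$ is graded by conjugation with $\gamma$ and $*$ is the adjoint. Let $(\mathcal E_M,\gamma_M,c)$ and $(\mathcal E_B,\gamma_B,c)$ be spinor modules for $\mathrm{Cl}(M)$ and $\mathrm{Cl}(B)$ (spin$^c$ structures on $M$ and $B$). Let $\mathcal E_H:=\mathcal E_B\otimes_{C^\infty(B)}C^\infty(M)$, with grading $\gamma_H:=\gamma_B\otimes1$, the pulled back hermitian form and the horizontal Clifford action $c_H:\mathrm{Cl}_H(M)\to\mathrm{End}_{C^\infty(M)}(\mathcal E_H)$, $c_H(X):=\widetilde c(d\pi(X))$ for $X\in\mathcal X_H(M)$, where $\widetilde c(Y\otimes f)(t\otimes g):=c(Y)t\otimes fg$. Define $\mathcal E_V:=\mathcal E_H^*\otimes_{\mathrm{Cl}_H(M)}\mathcal E_M$ with grading operator $\gamma_V:=\gamma_H^*\otimes\gamma_M$ and hermitian form $$\big\langle \langle\xi_1|\otimes s_1,\langle\xi_2|\otimes s_2\big\rangle_{\mathcal E_V}:=\big\langle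 s_1,(|\xi_1\rangle\langle\xi_2|)s_2\big\rangle_{\mathcal E_M},$$ where $|\xi_1\rangle\langle\xi_2|\in\mathrm{End}_{C^\infty(M)}(\mathcal E_H)$ acts on $\mathcal E_M$ through $c$ and the element of $\mathrm{Cl}_H(M)$ corresponding to it under $c_H$. Then this hermitian form is well defined, positive and non-degenerate (it identifies $\mathcal E_V$ with its conjugate dual), and the vertical Clifford action $$c_V:\mathrm{Cl}_V(M)\to\mathrm{End}_{C^\infty(M)}(\mathcal E_V),\qquad c_V(X):=\gamma_H^*\otimes c(X)\quad (X\in\mathcal X_V(M)),$$ is a well-defined isomorphism of $\mathbb Z/2$-graded $*$-algebras. In particular $\mathcal E_V$, with $\gamma_V$, this hermitian form and $c_V$, is a spinor module for the complex Clifford algebra of the vertical tangent bundle $\ker d\pi$, that is, a K-orientation of the Riemannian submersion $\pi$. -/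

import Mathlib

open scoped TensorProduct Manifold ContDiff Bundle

set_option linter.unusedSectionVars false

noncomputable section
namespace VertClif

section Algebra

variable {R : Type*} [CommRing R] [StarRing R]

/-- A complexified metric module over a commutative ring `R` with involution: a module `V` of
"complex vectors" with a symmetric `R`-bilinear form and a complex conjugation compatible with it.
The hermitian form is `(X, Y) ↦ bilin (conj X) Y`; the two forms agree on real vectors. -/
structure ComplexMetric (R V : Type*) [CommRing R] [StarRing R] [AddCommGroup V] [Module R V] where
  bilin : LinearMap.BilinForm R V
  symm : ∀ X Y, bilin X Y = bilin Y X
  conj : V →ₗ⋆[R] V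
  conj_conj : ∀ X, conj (conj X) = X
  bilin_conj : ∀ X Y, bilin (conj X) (conj Y) = star (bilin X Y)

namespace ComplexMetric
variable {V : Type*} [AddCommGroup V] [Module R V] (g : ComplexMetric R V)

/-- The quadratic form `X ↦ bilin X X`. -/
def quadratic : QuadraticForm R V := LinearMap.BilinMap.toQuadraticMap g.bilin

/-- The complex Clifford algebra: generated by `V` with `X * Y + Y * X = 2 * bilin X Y`.
Its `ℤ/2`-grading is given by the automorphism `CliffordAlgebra.involute`. -/
abbrev Cl : Type _ := CliffordAlgebra g.quadratic

/-- The inclusion of the vectors in the Clifford algebra. -/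
abbrev ι : V →ₗ[R] g.Cl := CliffordAlgebra.ι g.quadratic

/-- The opposite algebra, with scalars acting through the conjugation of `R`; a bookkeeping device
for the definition of the involution `cstar`. -/
def ConjOp (g : ComplexMetric R V) : Type _ := (g.Cl)ᵐᵒᵖ

instance : Ring g.ConjOp := inferInstanceAs (Ring (g.Cl)ᵐᵒᵖ)

instance : Algebra R g.ConjOp :=
  RingHom.toAlgebra' ((algebraMap R (g.Cl)ᵐᵒᵖ).comp (starRingEnd R))
    (fun r x => Algebra.commutes (A := (g.Cl)ᵐᵒᵖ) (star r) x)

theorem conjOp_smul (r : R) (a : g.Cl) :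
    (r • (show g.ConjOp from MulOpposite.op a)) =
      (show g.ConjOp from MulOpposite.op (star r • a)) := by
  rw [Algebra.smul_def, Algebra.smul_def, Algebra.commutes]; rfl

/-- `cstar` as a homomorphism into the conjugate opposite algebra. -/
def cstarHom : g.Cl →ₐ[R] g.ConjOp :=
  CliffordAlgebra.lift g.quadratic
    ⟨{ toFun := fun X => (show g.ConjOp from MulOpposite.op (g.ι (g.conj X)))
       map_add' := fun X Y => by
        rw [map_add, map_add]; rfl
       map_smul' := fun r X => by
        rw [LinearMap.map_smulₛₗ, LinearMap.map_smul, RingHom.id_apply, conjOp_smul]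
        rfl },
      fun X => by
        change MulOpposite.op (g.ι (g.conj X) * g.ι (g.conj X)) = _
        rw [CliffordAlgebra.ι_sq_scalar]
        change _ = MulOpposite.op (algebraMap R g.Cl (star (g.bilin X X)))
        rw [← g.bilin_conj]
        rfl⟩

/-- The `*`-operation of the Clifford algebra: the conjugate-linear anti-automorphism with
`cstar (ι X) = ι (conj X)`, so that real vectors are self-adjoint. -/
def cstar (a : g.Cl) : g.Cl := MulOpposite.unop (show (g.Cl)ᵐᵒᵖ from g.cstarHom a)

theorem cstar_ι (X : V) : g.cstar (g.ι X) = g.ι (g.conj X) := by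
  unfold cstar cstarHom
  erw [CliffordAlgebra.lift_ι_apply]
  rfl

theorem cstar_mul (a b : g.Cl) : g.cstar (a * b) = g.cstar b * g.cstar a := by
  unfold cstar
  rw [map_mul]; rfl

theorem cstar_add (a b : g.Cl) : g.cstar (a + b) = g.cstar a + g.cstar b := by
  unfold cstar
  rw [map_add]; rfl

theorem cstar_algebraMap (r : R) :
    g.cstar (algebraMap R _ r) = algebraMap R _ (star r) := by
  unfold cstar
  rw [AlgHom.commutes]; rfl

theorem cstar_cstar (a : g.Cl) : g.cstar (g.cstar a) = a := by
  induction a using CliffordAlgebra.induction with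
  | algebraMap r => rw [cstar_algebraMap, cstar_algebraMap, star_star]
  | ι X => rw [cstar_ι, cstar_ι, g.conj_conj]
  | mul a b ha hb => rw [cstar_mul, cstar_mul, ha, hb]
  | add a b ha hb => rw [cstar_add, cstar_add, ha, hb]

/-- Restriction to a submodule that is stable under conjugation. -/
def restrict (p : Submodule R V) (hp : ∀ X ∈ p, g.conj X ∈ p) : ComplexMetric R p where
  bilin := g.bilin.restrict p
  symm X Y := g.symm X Y
  conj :=
    { toFun := fun X => ⟨g.conj X, hp X X.2⟩
      map_add' := fun _ _ => Subtype.ext (map_add g.conj _ _)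
      map_smul' := fun _ _ => Subtype.ext (LinearMap.map_smulₛₗ g.conj _ _) }
  conj_conj X := Subtype.ext (g.conj_conj X)
  bilin_conj X Y := g.bilin_conj X Y

/-- The subalgebra of the Clifford algebra generated by the vectors in `p`. -/
def subalgebra (p : Submodule R V) : Subalgebra R g.Cl := Algebra.adjoin R (g.ι '' p)

theorem involute_mem_subalgebra (p : Submodule R V) {a : g.Cl} (ha : a ∈ g.subalgebra p) :
    CliffordAlgebra.involute a ∈ g.subalgebra p := by
  induction ha using Algebra.adjoin_induction with
  | mem x hx =>
    obtain ⟨X, hX, rfl⟩ := hx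
    rw [CliffordAlgebra.involute_ι]
    exact neg_mem (Algebra.subset_adjoin ⟨X, hX, rfl⟩)
  | algebraMap r => rw [AlgHom.commutes]; exact Subalgebra.algebraMap_mem _ _
  | add x y _ _ hx hy => rw [map_add]; exact add_mem hx hy
  | mul x y _ _ hx hy => rw [map_mul]; exact mul_mem hx hy

theorem cstar_mem_subalgebra (p : Submodule R V) (hp : ∀ X ∈ p, g.conj X ∈ p)
    {a : g.Cl} (ha : a ∈ g.subalgebra p) : g.cstar a ∈ g.subalgebra p := by
  induction ha using Algebra.adjoin_induction with
  | mem x hx =>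
    obtain ⟨X, hX, rfl⟩ := hx
    rw [cstar_ι]
    exact Algebra.subset_adjoin ⟨_, hp X hX, rfl⟩
  | algebraMap r => rw [cstar_algebraMap]; exact Subalgebra.algebraMap_mem _ _
  | add x y _ _ hx hy => rw [cstar_add]; exact add_mem hx hy
  | mul x y _ _ hx hy => rw [cstar_mul]; exact mul_mem hy hx

end ComplexMetric

/-- A hermitian form on an `R`-module (conjugate linear in the first variable): hermitian symmetric,
positive, and non-degenerate in the sense that it identifies the module with its dual. On a finitely
generated projective `C^∞(M)`-module this is a smooth hermitian metric on the vector bundle. -/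
structure HermitianForm (R E : Type*) [CommRing R] [StarRing R] [PartialOrder R]
    [AddCommGroup E] [Module R E] where
  form : E →ₗ⋆[R] E →ₗ[R] R
  star_form : ∀ s t, star (form s t) = form t s
  nonneg : ∀ s, 0 ≤ form s s
  perfect : Function.Bijective (fun s => (form s : Module.Dual R E))

/-- A (`ℤ/2`-graded, hermitian) spinor module for the Clifford algebra of `g`: a finitely generated
projective module with grading operator `γ`, a hermitian form, and an isomorphism
`c : Cl ≃ End_R(E)` of `ℤ/2`-graded `*`-algebras.
The grading of `End_R(E)` is conjugation by `γ`, its `*` is the adjoint for the hermitian form. -/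
structure SpinorModule {R V : Type*} [CommRing R] [StarRing R] [PartialOrder R]
    [AddCommGroup V] [Module R V] (g : ComplexMetric R V)
    (E : Type*) [AddCommGroup E] [Module R E] where
  finite : Module.Finite R E
  projective : Module.Projective R E
  γ : Module.End R E
  γ_sq : γ * γ = 1
  herm : HermitianForm R E
  γ_selfAdjoint : ∀ s t, herm.form (γ s) t = herm.form s (γ t)
  c : g.Cl ≃ₐ[R] Module.End R E
  c_involute : ∀ a, c (CliffordAlgebra.involute a) = γ * c a * γ
  c_cstar : ∀ a s t, herm.form (c (g.cstar a) s) t = herm.form s (c a t)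

section BaseChange

variable {A : Type*} [CommRing A] [StarRing A] [Algebra A R] [StarModule A R]
  {E : Type*} [AddCommGroup E] [Module A E]

/-- Auxiliary additive version of `sesqBaseChange`. -/
def sesqBaseChangeAux (h : E →ₗ⋆[A] E →ₗ[A] A) :
    (R ⊗[A] E) →+ Module.Dual R (R ⊗[A] E) :=
  TensorProduct.liftAddHom
    { toFun := fun f =>
        { toFun := fun s => star f •
            (LinearMap.liftBaseChange R ((Algebra.linearMap A R).comp (h s)))
          map_zero' := by ext; simp
          map_add' := fun s t => by ext; simp [mul_add] }
      map_zero' := by ext; simp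
      map_add' := fun f g => by ext; simp [add_mul] }
    (fun a f s => by
      ext
      simp [mul_assoc, mul_left_comm, Algebra.smul_def, starRingEnd_apply, algebraMap_star_comm])

/-- Base change of a sesquilinear form: `⟨f ⊗ s, g ⊗ t⟩ = f̄ ⟨s, t⟩ g`. -/
def sesqBaseChange (h : E →ₗ⋆[A] E →ₗ[A] A) :
    (R ⊗[A] E) →ₗ⋆[R] (R ⊗[A] E) →ₗ[R] R where
  toFun := sesqBaseChangeAux h
  map_add' := map_add _
  map_smul' f t := by
    induction t using TensorProduct.induction_on with
    | zero => rw [smul_zero, map_zero, smul_zero]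
    | tmul g s =>
      ext
      simp [sesqBaseChangeAux, TensorProduct.smul_tmul', mul_assoc, starRingEnd_apply]
    | add t u ht hu => rw [smul_add, map_add, map_add, smul_add, ht, hu]

theorem sesqBaseChange_tmul (h : E →ₗ⋆[A] E →ₗ[A] A) (f g : R) (s t : E) :
    sesqBaseChange h (f ⊗ₜ[A] s) (g ⊗ₜ[A] t) = star f * algebraMap A R (h s t) * g := by
  simp [sesqBaseChange, sesqBaseChangeAux]; ring

end BaseChange

section Balanced

variable {R P N C : Type*} [CommRing R] [AddCommGroup P] [Module R P] [AddCommGroup N] [Module R N]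

/-- The relations `p · a ⊗ s = p ⊗ a · s`. -/
def balancedRelations (ρ : C → Module.End R P) (l : C → Module.End R N) :
    Submodule R (P ⊗[R] N) :=
  Submodule.span R { z | ∃ (p : P) (a : C) (s : N), z = (ρ a p) ⊗ₜ[R] s - p ⊗ₜ[R] (l a s) }

/-- The tensor product `P ⊗_C N` over a not necessarily commutative `R`-algebra `C` acting on `P` from
the right by `ρ` and on `N` from the left by `l`. -/
def BalancedTensor (ρ : C → Module.End R P) (l : C → Module.End R N) : Type _ :=
  (P ⊗[R] N) ⧸ balancedRelations ρ l

namespace BalancedTensor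

variable {ρ : C → Module.End R P} {l : C → Module.End R N}

instance : AddCommGroup (BalancedTensor ρ l) :=
  inferInstanceAs (AddCommGroup ((P ⊗[R] N) ⧸ balancedRelations ρ l))

instance : Module R (BalancedTensor ρ l) :=
  inferInstanceAs (Module R ((P ⊗[R] N) ⧸ balancedRelations ρ l))

/-- The elementary tensor `p ⊗ s`. -/
def mk (p : P) (s : N) : BalancedTensor ρ l := (balancedRelations ρ l).mkQ (p ⊗ₜ[R] s)

/-- The operator `f ⊗ T`, well defined if `f` and `T` intertwine the actions of `C` with the twist `α`. -/
def twistedMap (α : C → C) (f : Module.End R P) (T : Module.End R N)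
    (hf : ∀ a, f * ρ a = ρ (α a) * f) (hT : ∀ a, T * l a = l (α a) * T) :
    Module.End R (BalancedTensor ρ l) :=
  Submodule.mapQ (balancedRelations ρ l) (balancedRelations ρ l) (TensorProduct.map f T) (by
    refine Submodule.span_le.2 ?_
    rintro _ ⟨p, a, s, rfl⟩
    refine Submodule.subset_span ⟨f p, α a, T s, ?_⟩
    have h1 := LinearMap.congr_fun (hf a) p
    have h2 := LinearMap.congr_fun (hT a) s
    simp only [Module.End.mul_apply] at h1 h2
    simp only [map_sub, TensorProduct.map_tmul, h1, h2])

theorem twistedMap_mk (α : C → C) (f : Module.End R P) (T : Module.End R N)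
    (hf : ∀ a, f * ρ a = ρ (α a) * f) (hT : ∀ a, T * l a = l (α a) * T) (p : P) (s : N) :
    twistedMap (ρ := ρ) (l := l) α f T hf hT (mk p s) = mk (f p) (T s) :=
  rfl

end BalancedTensor

end Balanced

section Submersion

variable {A R W V : Type*} [CommRing A] [StarRing A] [PartialOrder A]
  [CommRing R] [StarRing R] [PartialOrder R] [Algebra A R]
  [AddCommGroup W] [Module A W] [AddCommGroup V] [Module R V]

/-- The horizontal vectors: the orthogonal complement of the vertical ones, `ker D`. -/
def horizontal (gV : ComplexMetric R V) (D : V →ₗ[R] R ⊗[A] W) : Submodule R V :=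
  gV.bilin.orthogonal (LinearMap.ker D)

/-- `D : V → R ⊗ W` is the differential of a Riemannian submersion: it is surjective, and an isometric
isomorphism on the orthogonal complement of its kernel. -/
structure IsRiemannianDifferential (gV : ComplexMetric R V) (gW : ComplexMetric A W)
    (D : V →ₗ[R] R ⊗[A] W) : Prop where
  surjective : Function.Surjective D
  bijective : Function.Bijective (D.domRestrict (horizontal gV D))
  isometry : ∀ X ∈ horizontal gV D, ∀ Y ∈ horizontal gV D,
    gW.bilin.baseChange R (D X) (D Y) = gV.bilin X Y

/-- The metric on the horizontal vectors, as a quadratic form. -/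
def horizontalForm (gV : ComplexMetric R V) (D : V →ₗ[R] R ⊗[A] W) :
    QuadraticForm R (horizontal gV D) :=
  gV.quadratic.comp (horizontal gV D).subtype

/-- The horizontal Clifford algebra, generated by the horizontal vectors. -/
abbrev HorizontalClifford (gV : ComplexMetric R V) (D : V →ₗ[R] R ⊗[A] W) : Type _ :=
  CliffordAlgebra (horizontalForm gV D)

/-- The inclusion of the horizontal Clifford algebra in the Clifford algebra. -/
def horizontalInclusion (gV : ComplexMetric R V) (D : V →ₗ[R] R ⊗[A] W) :
    HorizontalClifford gV D →ₐ[R] gV.Cl :=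
  CliffordAlgebra.map ⟨(horizontal gV D).subtype, fun _ => rfl⟩

variable {gV : ComplexMetric R V} {gW : ComplexMetric A W} {D : V →ₗ[R] R ⊗[A] W}
  {EB : Type*} [AddCommGroup EB] [Module A EB]
  {EM : Type*} [AddCommGroup EM] [Module R EM]

variable (R) in
/-- The map `f ⊗ Y ↦ (g ⊗ t ↦ f g ⊗ c(Y) t)` from `R ⊗ W` to the endomorphisms of the horizontal
spinor module `E_H = R ⊗ E_B`, the pullback of the spinor module of the base. -/
def pulledClifford (SB : SpinorModule gW EB) :
    R ⊗[A] W →ₗ[R] Module.End R (R ⊗[A] EB) :=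
  LinearMap.liftBaseChange R
    ((LinearMap.baseChangeHom A R EB EB).comp (SB.c.toLinearMap.comp gW.ι))

theorem pulledClifford_tmul (SB : SpinorModule gW EB) (f g : R) (Y : W) (s : EB) :
    pulledClifford R SB (f ⊗ₜ Y) (g ⊗ₜ s) = (f * g) ⊗ₜ SB.c (gW.ι Y) s := by
  simp [pulledClifford, TensorProduct.smul_tmul']

theorem end_pullback_ext {E : Type*} [AddCommGroup E] [Module A E] {S T : Module.End R (R ⊗[A] E)}
    (h : ∀ (f : R) (s : E), S (f ⊗ₜ s) = T (f ⊗ₜ s)) : S = T := by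
  refine LinearMap.ext fun z => ?_
  induction z using TensorProduct.induction_on with
  | zero => rw [map_zero, map_zero]
  | tmul f s => exact h f s
  | add z w hz hw => rw [map_add, map_add, hz, hw]

theorem pulledClifford_anticomm (SB : SpinorModule gW EB) (t u : R ⊗[A] W) :
    pulledClifford R SB t * pulledClifford R SB u + pulledClifford R SB u * pulledClifford R SB t
      = algebraMap R _ (2 * gW.bilin.baseChange R t u) := by
  induction t using TensorProduct.induction_on with
  | zero => simp
  | add t t' ht ht' =>
    simp only [map_add, add_mul, mul_add, LinearMap.add_apply] at ht ht' ⊢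
    rw [← ht, ← ht']; abel
  | tmul f Y =>
    induction u using TensorProduct.induction_on with
    | zero => simp
    | add t t' ht ht' =>
      simp only [map_add, add_mul, mul_add] at ht ht' ⊢
      rw [← ht, ← ht']; abel
    | tmul g Z =>
      have key : SB.c (gW.ι Y) * SB.c (gW.ι Z) + SB.c (gW.ι Z) * SB.c (gW.ι Y) =
          algebraMap A _ (2 * gW.bilin Y Z) := by
        rw [← map_mul SB.c, ← map_mul SB.c, ← map_add SB.c, CliffordAlgebra.ι_mul_ι_add_swap,
          AlgEquiv.commutes]
        congr 1
        simp only [ComplexMetric.quadratic, QuadraticMap.polar,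
          LinearMap.BilinMap.toQuadraticMap_apply, map_add, LinearMap.add_apply, gW.symm Z Y]
        ring
      refine end_pullback_ext fun k s => ?_
      have key' := LinearMap.congr_fun key s
      simp only [LinearMap.add_apply, Module.End.mul_apply, Module.algebraMap_end_apply] at key'
      simp only [LinearMap.add_apply, Module.End.mul_apply, pulledClifford_tmul,
        Module.algebraMap_end_apply, LinearMap.BilinForm.baseChange_tmul]
      rw [mul_left_comm g f, ← TensorProduct.tmul_add, key', TensorProduct.tmul_smul,
        TensorProduct.smul_tmul', TensorProduct.smul_tmul']
      congr 1
      simp only [Algebra.smul_def, map_mul, map_ofNat, Algebra.algebraMap_self, RingHom.id_apply]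
      ring

theorem pulledClifford_sq (SB : SpinorModule gW EB) (t : R ⊗[A] W) :
    pulledClifford R SB t * pulledClifford R SB t
      = algebraMap R _ (gW.bilin.baseChange R t t) := by
  induction t using TensorProduct.induction_on with
  | zero => simp
  | tmul f Y =>
    have key : SB.c (gW.ι Y) * SB.c (gW.ι Y) = algebraMap A _ (gW.bilin Y Y) := by
      rw [← map_mul SB.c, CliffordAlgebra.ι_sq_scalar, AlgEquiv.commutes]
      rfl
    refine end_pullback_ext fun k s => ?_
    have key' := LinearMap.congr_fun key s
    simp only [Module.End.mul_apply, Module.algebraMap_end_apply] at key'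
    simp only [Module.End.mul_apply, pulledClifford_tmul,
      Module.algebraMap_end_apply, LinearMap.BilinForm.baseChange_tmul]
    rw [key', TensorProduct.tmul_smul, TensorProduct.smul_tmul', TensorProduct.smul_tmul']
    congr 1
    simp only [Algebra.smul_def, Algebra.algebraMap_self, RingHom.id_apply]
    ring
  | add t u ht hu =>
    have h := pulledClifford_anticomm SB t u
    have hs : gW.bilin.baseChange R u t = gW.bilin.baseChange R t u :=
      (LinearMap.BilinForm.IsSymm.baseChange R ⟨fun X Y => gW.symm X Y⟩).eq u t
    have e : gW.bilin.baseChange R (t + u) (t + u) = gW.bilin.baseChange R t t +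
        2 * gW.bilin.baseChange R t u + gW.bilin.baseChange R u u := by
      simp only [map_add, LinearMap.add_apply, hs]
      ring
    rw [e, map_add (algebraMap R _), map_add (algebraMap R _), ← h, ← ht, ← hu, map_add, add_mul, mul_add, mul_add]
    abel

/-- The horizontal Clifford action on `E_H = R ⊗ E_B`, with `c_H(X) = c(D X)` for horizontal `X`. -/
def horizontalAction (hD : IsRiemannianDifferential gV gW D) (SB : SpinorModule gW EB) :
    HorizontalClifford gV D →ₐ[R] Module.End R (R ⊗[A] EB) :=
  CliffordAlgebra.lift (horizontalForm gV D)
    ⟨(pulledClifford R SB).comp (D.domRestrict (horizontal gV D)), fun X => by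
      change pulledClifford R SB (D X) * pulledClifford R SB (D X) = _
      rw [pulledClifford_sq, hD.isometry X X.2 X X.2]
      rfl⟩

theorem horizontalAction_ι (hD : IsRiemannianDifferential gV gW D) (SB : SpinorModule gW EB)
    (X : horizontal gV D) :
    horizontalAction hD SB (CliffordAlgebra.ι _ X) = pulledClifford R SB (D X) := by
  unfold horizontalAction
  rw [CliffordAlgebra.lift_ι_apply]
  rfl

variable (R) in
/-- The grading operator `1 ⊗ γ_B` of `E_H = R ⊗ E_B`. -/
def horizontalGrading (SB : SpinorModule gW EB) : Module.End R (R ⊗[A] EB) :=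
  SB.γ.baseChange R

theorem horizontalGrading_sq (SB : SpinorModule gW EB) :
    horizontalGrading R SB * horizontalGrading R SB = 1 := by
  ext s
  have := LinearMap.congr_fun SB.γ_sq s
  simp only [Module.End.mul_apply, Module.End.one_apply] at this
  simp [horizontalGrading, this]

theorem grading_mul_pulledClifford (SB : SpinorModule gW EB) (t : R ⊗[A] W) :
    pulledClifford R SB t * horizontalGrading R SB =
      horizontalGrading R SB * pulledClifford R SB (-t) := by
  induction t using TensorProduct.induction_on with
  | zero => simp
  | add t u ht hu => rw [neg_add, map_add, map_add, mul_add, add_mul, ht, hu]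
  | tmul f Y =>
    have key := SB.c_involute (gW.ι (-Y))
    rw [CliffordAlgebra.involute_ι, map_neg gW.ι, neg_neg] at key
    rw [← TensorProduct.tmul_neg]
    refine end_pullback_ext fun k s => ?_
    have key' : SB.c (gW.ι Y) * SB.γ = SB.γ * SB.c (gW.ι (-Y)) := by
      rw [key, mul_assoc, SB.γ_sq, mul_one, map_neg gW.ι]
    have key'' := LinearMap.congr_fun key' s
    simp only [Module.End.mul_apply] at key''
    simp only [Module.End.mul_apply, horizontalGrading, LinearMap.baseChange_tmul,
      pulledClifford_tmul, key'']

theorem horizontalAction_involute (hD : IsRiemannianDifferential gV gW D)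
    (SB : SpinorModule gW EB) (a : HorizontalClifford gV D) :
    horizontalAction hD SB a * horizontalGrading R SB =
      horizontalGrading R SB * horizontalAction hD SB (CliffordAlgebra.involute a) := by
  induction a using CliffordAlgebra.induction with
  | algebraMap r =>
    rw [AlgHom.commutes CliffordAlgebra.involute, AlgHom.commutes, Algebra.commutes]
  | ι X =>
    rw [CliffordAlgebra.involute_ι, ← map_neg, horizontalAction_ι, horizontalAction_ι,
      grading_mul_pulledClifford, Submodule.coe_neg, map_neg D]
  | mul a b ha hb => rw [map_mul, map_mul, map_mul, mul_assoc, hb, ← mul_assoc, ha, mul_assoc]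
  | add a b ha hb => rw [map_add, map_add, map_add, add_mul, mul_add, ha, hb]

theorem vertical_mul_horizontal (X : LinearMap.ker D) (a : HorizontalClifford gV D) :
    gV.ι X * horizontalInclusion gV D a =
      horizontalInclusion gV D (CliffordAlgebra.involute a) * gV.ι X := by
  induction a using CliffordAlgebra.induction with
  | algebraMap r => rw [AlgHom.commutes, AlgHom.commutes, AlgHom.commutes, Algebra.commutes]
  | ι Y =>
    have hYX : gV.bilin (X : V) (Y : V) = 0 := Y.2 X X.2
    rw [CliffordAlgebra.involute_ι, map_neg, neg_mul]
    unfold horizontalInclusion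
    rw [CliffordAlgebra.map_apply_ι]
    have h := CliffordAlgebra.ι_mul_ι_add_swap (Q := gV.quadratic) (X : V) (Y : V)
    have h0 : QuadraticMap.polar gV.quadratic (X : V) (Y : V) = 0 := by
      simp only [ComplexMetric.quadratic, QuadraticMap.polar,
        LinearMap.BilinMap.toQuadraticMap_apply, map_add, LinearMap.add_apply,
        gV.symm (Y : V) (X : V), hYX]
      ring
    rw [h0, map_zero] at h
    exact eq_neg_of_add_eq_zero_left h
  | mul a b ha hb => rw [map_mul, map_mul, map_mul, ← mul_assoc, ha, mul_assoc, hb, mul_assoc]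
  | add a b ha hb => rw [map_add, map_add, map_add, add_mul, mul_add, ha, hb]

/-- The vertical spinor module `E_V = E_H^* ⊗_{Cl_H} E_M`; the horizontal Clifford algebra acts on the
right of `E_H^*` by `ξ ↦ ξ ∘ c_H(a)` and on `E_M` by `c`. -/
abbrev VerticalSpinor (hD : IsRiemannianDifferential gV gW D)
    (SB : SpinorModule gW EB) (SM : SpinorModule gV EM) : Type _ :=
  BalancedTensor (fun a : HorizontalClifford gV D => (horizontalAction hD SB a).dualMap)
    (fun a => SM.c (horizontalInclusion gV D a))

theorem vertical_clifford_comm (SM : SpinorModule gV EM) (X : LinearMap.ker D)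
    (a : HorizontalClifford gV D) :
    SM.c (gV.ι X) * SM.c (horizontalInclusion gV D a) =
      SM.c (horizontalInclusion gV D (CliffordAlgebra.involute a)) * SM.c (gV.ι X) := by
  rw [← map_mul SM.c, ← map_mul SM.c, vertical_mul_horizontal]

theorem grading_clifford_comm (SM : SpinorModule gV EM) (a : HorizontalClifford gV D) :
    SM.γ * SM.c (horizontalInclusion gV D a) =
      SM.c (horizontalInclusion gV D (CliffordAlgebra.involute a)) * SM.γ := by
  have h : horizontalInclusion gV D (CliffordAlgebra.involute a) =
      CliffordAlgebra.involute (horizontalInclusion gV D a) := by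
    induction a using CliffordAlgebra.induction with
    | algebraMap r => simp only [AlgHom.commutes]
    | ι X => simp [horizontalInclusion]
    | mul a b ha hb => simp only [map_mul, ha, hb]
    | add a b ha hb => simp only [map_add, ha, hb]
  rw [h, SM.c_involute, mul_assoc, SM.γ_sq, mul_one]

theorem dualGrading_comm (hD : IsRiemannianDifferential gV gW D) (SB : SpinorModule gW EB)
    (a : HorizontalClifford gV D) :
    (horizontalGrading R SB).dualMap * (horizontalAction hD SB a).dualMap =
      (horizontalAction hD SB (CliffordAlgebra.involute a)).dualMap *
        (horizontalGrading R SB).dualMap := by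
  have h := horizontalAction_involute hD SB a
  refine LinearMap.ext fun ξ => LinearMap.ext fun z => ?_
  exact congrArg ξ (LinearMap.congr_fun h z)

/-- The grading operator `γ_V = γ_H^* ⊗ γ_M`. -/
def verticalGrading (hD : IsRiemannianDifferential gV gW D)
    (SB : SpinorModule gW EB) (SM : SpinorModule gV EM) :
    Module.End R (VerticalSpinor hD SB SM) :=
  BalancedTensor.twistedMap CliffordAlgebra.involute (horizontalGrading R SB).dualMap SM.γ
    (dualGrading_comm hD SB) (grading_clifford_comm SM)

/-- The vertical Clifford action of a vertical vector: `c_V(X) = γ_H^* ⊗ c(X)`. -/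
def verticalCliffordEnd (hD : IsRiemannianDifferential gV gW D)
    (SB : SpinorModule gW EB) (SM : SpinorModule gV EM) (X : LinearMap.ker D) :
    Module.End R (VerticalSpinor hD SB SM) :=
  BalancedTensor.twistedMap CliffordAlgebra.involute (horizontalGrading R SB).dualMap
    (SM.c (gV.ι X)) (dualGrading_comm hD SB) (vertical_clifford_comm SM X)

variable (R) in
/-- The hermitian form of `E_H = R ⊗ E_B`; `pulledHermitian R SB ξ` is the bra `⟨ξ| ∈ E_H^*`. -/
def pulledHermitian [StarModule A R] (SB : SpinorModule gW EB) :
    (R ⊗[A] EB) →ₗ⋆[R] (R ⊗[A] EB) →ₗ[R] R :=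
  sesqBaseChange SB.herm.form

/-- The rank one operator `|ξ⟩⟨η| : ζ ↦ ξ ⟨η, ζ⟩` on `E_H`. -/
def ketbra [StarModule A R] (SB : SpinorModule gW EB) (ξ η : R ⊗[A] EB) :
    Module.End R (R ⊗[A] EB) :=
  (pulledHermitian R SB η).smulRight ξ

/-- The vertical Clifford algebra `Cl_V ⊆ Cl`: the subalgebra generated by the vertical vectors. -/
def verticalClifford (gV : ComplexMetric R V) (D : V →ₗ[R] R ⊗[A] W) : Subalgebra R gV.Cl :=
  gV.subalgebra (LinearMap.ker D)

/-- A vertical vector as an element of the vertical Clifford algebra. -/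
def verticalι (gV : ComplexMetric R V) (D : V →ₗ[R] R ⊗[A] W) (X : LinearMap.ker D) :
    verticalClifford gV D :=
  ⟨gV.ι X, Algebra.subset_adjoin ⟨X, X.2, rfl⟩⟩

/-- The grading automorphism of `Cl_V`, inherited from `Cl`. -/
def verticalInvolute (a : verticalClifford gV D) : verticalClifford gV D :=
  ⟨CliffordAlgebra.involute (a : gV.Cl), gV.involute_mem_subalgebra _ a.2⟩

/-- The `*`-operation of `Cl_V`, inherited from `Cl`. -/
def verticalCstar (hD : ∀ X ∈ LinearMap.ker D, gV.conj X ∈ LinearMap.ker D)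
    (a : verticalClifford gV D) : verticalClifford gV D :=
  ⟨gV.cstar (a : gV.Cl), gV.cstar_mem_subalgebra _ hD a.2⟩

/-- `h` is the hermitian form of the vertical spinor module:
`⟨⟨ξ₁| ⊗ s₁, ⟨ξ₂| ⊗ s₂⟩ = ⟨s₁, |ξ₁⟩⟨ξ₂| s₂⟩`, where `|ξ₁⟩⟨ξ₂|` acts on `E_M` as the element of the
horizontal Clifford algebra that corresponds to it under `c_H`. -/
def IsVerticalHermitian [StarModule A R] (hD : IsRiemannianDifferential gV gW D)
    (SB : SpinorModule gW EB) (SM : SpinorModule gV EM)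
    (h : VerticalSpinor hD SB SM →ₗ⋆[R] VerticalSpinor hD SB SM →ₗ[R] R) : Prop :=
  ∀ (ξ₁ ξ₂ : R ⊗[A] EB) (s₁ s₂ : EM), ∃ a : HorizontalClifford gV D,
    horizontalAction hD SB a = ketbra SB ξ₁ ξ₂ ∧
    h (BalancedTensor.mk (pulledHermitian R SB ξ₁) s₁)
        (BalancedTensor.mk (pulledHermitian R SB ξ₂) s₂) =
      SM.herm.form s₁ (SM.c (horizontalInclusion gV D a) s₂)

end Submersion
end Algebra

section Geometry

open Bundle

variable {E : Type*} [NormedAddCommGroup E] [NormedSpace ℝ E]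
  {H : Type*} [TopologicalSpace H] (I : ModelWithCorners ℝ E H)
  (M : Type*) [TopologicalSpace M] [ChartedSpace H M]

instance contMDiffRing_complex : ContMDiffRing 𝓘(ℝ, ℂ) ∞ ℂ :=
  { instNormedSpaceLieAddGroup with
    contMDiff_mul := by
      rw [contMDiff_iff]
      refine ⟨continuous_mul, fun x y => ?_⟩
      simp only [mfld_simps, chartAt_self_eq]
      rw [contDiffOn_univ]
      exact contDiff_mul }

/-- The ring `C^∞(M)` of smooth complex valued functions, with complex conjugation as involution and
the pointwise order. -/
abbrev SmoothC : Type _ := C^∞⟮I, M; 𝓘(ℝ, ℂ), ℂ⟯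

namespace SmoothC

variable {I M}

instance : StarRing (SmoothC I M) where
  star f := ⟨fun x => star (f x),
    (Complex.conjCLE.contDiff.contMDiff (n := ∞)).comp f.contMDiff⟩
  star_involutive f := by ext x; exact star_star (f x)
  star_mul f g := by ext x; exact star_mul (f x) (g x)
  star_add f g := by ext x; exact star_add (f x) (g x)

theorem add_apply (f g : SmoothC I M) (x : M) : (f + g) x = f x + g x := rfl

theorem mul_apply (f g : SmoothC I M) (x : M) : (f * g) x = f x * g x := rfl

theorem smul_apply (f g : SmoothC I M) (x : M) : (f • g) x = f x * g x := rfl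

theorem star_re_apply (f : SmoothC I M) (x : M) : ((star f) x).re = (f x).re := rfl

theorem star_im_apply (f : SmoothC I M) (x : M) : ((star f) x).im = -(f x).im := rfl

theorem star_apply (f : SmoothC I M) (x : M) : (star f) x = star (f x) := rfl

open scoped ComplexOrder in
instance : PartialOrder (SmoothC I M) :=
  PartialOrder.lift (fun f => (f : M → ℂ)) DFunLike.coe_injective

/-- Real part. -/
def re (f : SmoothC I M) : C^∞⟮I, M; 𝓘(ℝ, ℝ), ℝ⟯ :=
  ⟨fun x => (f x).re, (Complex.reCLM.contDiff.contMDiff (n := ∞)).comp f.contMDiff⟩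

/-- Imaginary part. -/
def im (f : SmoothC I M) : C^∞⟮I, M; 𝓘(ℝ, ℝ), ℝ⟯ :=
  ⟨fun x => (f x).im, (Complex.imCLM.contDiff.contMDiff (n := ∞)).comp f.contMDiff⟩

/-- The function `u + i v`. -/
def mk' (u v : M → ℝ) (hu : ContMDiff I 𝓘(ℝ, ℝ) ∞ u) (hv : ContMDiff I 𝓘(ℝ, ℝ) ∞ v) :
    SmoothC I M :=
  ⟨fun x => ⟨u x, v x⟩, by
    have h : (fun x => (⟨u x, v x⟩ : ℂ)) = fun x => Complex.ofRealCLM (u x) +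
        (Complex.I * Complex.ofRealCLM (v x)) := by
      funext x; apply Complex.ext <;> simp
    rw [h]
    have h1 := (Complex.ofRealCLM.contDiff.contMDiff (n := ∞)).comp hu
    have h2 := (Complex.ofRealCLM.contDiff.contMDiff (n := ∞)).comp hv
    exact h1.add (contMDiff_const.mul h2)⟩

end SmoothC

variable [IsManifold I ∞ M]

/-- A smooth complex vector field `re + i im`. -/
@[ext]
structure ComplexVectorField where
  re : Cₛ^∞⟮I; E, (TangentSpace I : M → Type _)⟯
  im : Cₛ^∞⟮I; E, (TangentSpace I : M → Type _)⟯

namespace ComplexVectorField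

variable {I M}

/-- A complex vector field as a pair of real ones. -/
def equivProd : ComplexVectorField I M ≃
    Cₛ^∞⟮I; E, (TangentSpace I : M → Type _)⟯ × Cₛ^∞⟮I; E, (TangentSpace I : M → Type _)⟯ where
  toFun X := (X.re, X.im)
  invFun p := ⟨p.1, p.2⟩
  left_inv _ := rfl
  right_inv _ := rfl

instance : AddCommGroup (ComplexVectorField I M) := equivProd.addCommGroup

theorem add_re (X Y : ComplexVectorField I M) : (X + Y).re = X.re + Y.re := rfl
theorem add_im (X Y : ComplexVectorField I M) : (X + Y).im = X.im + Y.im := rfl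
theorem zero_re : (0 : ComplexVectorField I M).re = 0 := rfl
theorem zero_im : (0 : ComplexVectorField I M).im = 0 := rfl

theorem ext_apply {X Y : ComplexVectorField I M} (h1 : ∀ x, X.re x = Y.re x)
    (h2 : ∀ x, X.im x = Y.im x) : X = Y :=
  ComplexVectorField.ext (ContMDiffSection.ext h1) (ContMDiffSection.ext h2)

/-- Multiplication of a real vector field by a smooth real function. -/
def realSMul (f : C^∞⟮I, M; 𝓘(ℝ, ℝ), ℝ⟯) (X : Cₛ^∞⟮I; E, (TangentSpace I : M → Type _)⟯) :
    Cₛ^∞⟮I; E, (TangentSpace I : M → Type _)⟯ :=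
  ⟨fun x => f x • X x, f.contMDiff.smul_section X.contMDiff⟩

instance : SMul (SmoothC I M) (ComplexVectorField I M) where
  smul f X := ⟨realSMul f.re X.re - realSMul f.im X.im, realSMul f.re X.im + realSMul f.im X.re⟩

theorem smul_re_apply (f : SmoothC I M) (X : ComplexVectorField I M) (x : M) :
    (f • X).re x = (f x).re • X.re x - (f x).im • X.im x := rfl
theorem smul_im_apply (f : SmoothC I M) (X : ComplexVectorField I M) (x : M) :
    (f • X).im x = (f x).re • X.im x + (f x).im • X.re x := rfl
theorem add_re_apply (X Y : ComplexVectorField I M) (x : M) :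
    (X + Y).re x = X.re x + Y.re x := rfl
theorem add_im_apply (X Y : ComplexVectorField I M) (x : M) :
    (X + Y).im x = X.im x + Y.im x := rfl
theorem zero_re_apply (x : M) : (0 : ComplexVectorField I M).re x = 0 := rfl
theorem zero_im_apply (x : M) : (0 : ComplexVectorField I M).im x = 0 := rfl

instance : Module (SmoothC I M) (ComplexVectorField I M) where
  one_smul X := by
    refine ext_apply (fun x => ?_) (fun x => ?_) <;>
    simp [smul_re_apply, smul_im_apply]
  mul_smul f g X := by
    refine ext_apply (fun x => ?_) (fun x => ?_) <;>
    simp only [smul_re_apply, smul_im_apply, ContMDiffMap.coe_mul, Pi.mul_apply, Complex.mul_re,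
      Complex.mul_im] <;> module
  smul_zero f := by
    refine ext_apply (fun x => ?_) (fun x => ?_) <;>
    simp [smul_re_apply, smul_im_apply, zero_re_apply, zero_im_apply]
  zero_smul X := by
    refine ext_apply (fun x => ?_) (fun x => ?_) <;>
    simp [smul_re_apply, smul_im_apply, zero_re_apply, zero_im_apply]
  smul_add f X Y := by
    refine ext_apply (fun x => ?_) (fun x => ?_) <;>
    simp only [smul_re_apply, smul_im_apply, add_re_apply, add_im_apply] <;> module
  add_smul f g X := by
    refine ext_apply (fun x => ?_) (fun x => ?_) <;>
    simp only [smul_re_apply, smul_im_apply, add_re_apply, add_im_apply, ContMDiffMap.coe_add,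
      Pi.add_apply, Complex.add_re, Complex.add_im] <;> module

/-- Complex conjugation of vector fields. -/
def conj : ComplexVectorField I M →ₗ⋆[SmoothC I M] ComplexVectorField I M where
  toFun X := ⟨X.re, -X.im⟩
  map_add' X Y := by
    refine ext_apply (fun x => rfl) (fun x => ?_)
    simp only [ContMDiffSection.coe_neg, Pi.neg_apply, add_im_apply]
    exact neg_add _ _
  map_smul' f X := by
    refine ext_apply (fun x => ?_) (fun x => ?_)
    · simp only [smul_re_apply, ContMDiffSection.coe_neg, Pi.neg_apply, starRingEnd_apply,
        SmoothC.star_re_apply, SmoothC.star_im_apply]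
      module
    · simp only [smul_im_apply, ContMDiffSection.coe_neg, Pi.neg_apply, starRingEnd_apply,
        SmoothC.star_re_apply, SmoothC.star_im_apply]
      module

theorem conj_re_apply (X : ComplexVectorField I M) (x : M) : (conj X).re x = X.re x := rfl
theorem conj_im_apply (X : ComplexVectorField I M) (x : M) : (conj X).im x = -X.im x := rfl

end ComplexVectorField

variable [RiemannianBundle (fun x : M => TangentSpace I x)]
  [IsContMDiffRiemannianBundle I ∞ E (fun x : M => TangentSpace I x)]

variable {I M} in
theorem contMDiff_inner (X Y : Cₛ^∞⟮I; E, (TangentSpace I : M → Type _)⟯) :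
    ContMDiff I 𝓘(ℝ, ℝ) ∞ (fun x => inner ℝ (X x) (Y x)) :=
  ContMDiff.inner_bundle (E := fun x : M => TangentSpace I x) (b := fun x => x)
    (v := fun x => X x) (w := fun x => Y x) X.contMDiff Y.contMDiff

variable {I M} in
/-- The complex bilinear extension of the Riemannian metric to complex vector fields. -/
def pairing (X Y : ComplexVectorField I M) : SmoothC I M :=
  SmoothC.mk' (fun x => inner ℝ (X.re x) (Y.re x) - inner ℝ (X.im x) (Y.im x))
    (fun x => inner ℝ (X.re x) (Y.im x) + inner ℝ (X.im x) (Y.re x))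
    ((contMDiff_inner X.re Y.re).sub
      (contMDiff_inner X.im Y.im))
    ((contMDiff_inner X.re Y.im).add
      (contMDiff_inner X.im Y.re))

variable {I M} in
theorem pairing_re_apply (X Y : ComplexVectorField I M) (x : M) :
    (pairing X Y x).re = inner ℝ (X.re x) (Y.re x) - inner ℝ (X.im x) (Y.im x) := rfl

variable {I M} in
theorem pairing_im_apply (X Y : ComplexVectorField I M) (x : M) :
    (pairing X Y x).im = inner ℝ (X.re x) (Y.im x) + inner ℝ (X.im x) (Y.re x) := rfl

open ComplexVectorField in
/-- The module of complex vector fields with its Riemannian metric. -/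
def vectorFieldMetric : ComplexMetric (SmoothC I M) (ComplexVectorField I M) where
  bilin := LinearMap.mk₂ _ pairing
    (fun X X' Y => by
      refine ContMDiffMap.ext fun x => Complex.ext ?_ ?_ <;>
      simp only [SmoothC.add_apply, Complex.add_re, Complex.add_im, pairing_re_apply,
        pairing_im_apply, add_re_apply, add_im_apply, inner_add_left] <;> ring)
    (fun f X Y => by
      refine ContMDiffMap.ext fun x => Complex.ext ?_ ?_ <;>
      simp only [SmoothC.smul_apply, Complex.mul_re, Complex.mul_im, pairing_re_apply,
        pairing_im_apply, smul_re_apply, smul_im_apply, inner_add_left, inner_sub_left,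
        real_inner_smul_left] <;> ring)
    (fun X Y Y' => by
      refine ContMDiffMap.ext fun x => Complex.ext ?_ ?_ <;>
      simp only [SmoothC.add_apply, Complex.add_re, Complex.add_im, pairing_re_apply,
        pairing_im_apply, add_re_apply, add_im_apply, inner_add_right] <;> ring)
    (fun f X Y => by
      refine ContMDiffMap.ext fun x => Complex.ext ?_ ?_ <;>
      simp only [SmoothC.smul_apply, Complex.mul_re, Complex.mul_im, pairing_re_apply,
        pairing_im_apply, smul_re_apply, smul_im_apply, inner_add_right, inner_sub_right,
        real_inner_smul_right] <;> ring)
  symm X Y := by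
    refine ContMDiffMap.ext fun x => Complex.ext ?_ ?_
    · simp only [LinearMap.mk₂_apply, pairing_re_apply, real_inner_comm]
    · simp only [LinearMap.mk₂_apply, pairing_im_apply]
      rw [add_comm, real_inner_comm, real_inner_comm (X.re x)]
  conj := conj
  conj_conj X := by
    refine ext_apply (fun x => rfl) (fun x => ?_)
    exact neg_neg _
  bilin_conj X Y := by
    refine ContMDiffMap.ext fun x => Complex.ext ?_ ?_
    · simp only [LinearMap.mk₂_apply, SmoothC.star_re_apply, pairing_re_apply, conj_re_apply,
        conj_im_apply, inner_neg_left, inner_neg_right, neg_neg]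
    · simp only [LinearMap.mk₂_apply, SmoothC.star_im_apply, pairing_im_apply, conj_re_apply,
        conj_im_apply, inner_neg_left, inner_neg_right]
      ring

/-- The tangent bundle of a compact manifold has a finite global frame with dual coframe. -/
theorem exists_tangent_frame {E : Type*} [NormedAddCommGroup E] [NormedSpace ℝ E]
    {H : Type*} [TopologicalSpace H] (I : ModelWithCorners ℝ E H)
    (M : Type*) [TopologicalSpace M] [ChartedSpace H M] [IsManifold I ∞ M]
    [FiniteDimensional ℝ E] [T2Space M] [CompactSpace M] :
    ∃ (k : ℕ) (Y : Fin k → Cₛ^∞⟮I; E, (TangentSpace I : M → Type _)⟯)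
      (θ : Fin k → ∀ x : M, TangentSpace I x →ₗ[ℝ] ℝ),
      (∀ i, ContMDiff I.tangent 𝓘(ℝ, ℝ) ∞ (fun p : TangentBundle I M => θ i p.1 p.2)) ∧
      ∀ (x : M) (v : TangentSpace I x), ∑ i, θ i x v • Y i x = v := by
  obtain ⟨κ, fs, hfs⟩ := SmoothBumpCovering.exists_isSubordinate I (s := (Set.univ : Set M))
    (U := fun x => (trivializationAt E (TangentSpace I : M → Type _) x).baseSet) isClosed_univ
    (fun x _ => (trivializationAt E (TangentSpace I : M → Type _) x).open_baseSet.mem_nhds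
      (FiberBundle.mem_baseSet_trivializationAt' x))
  let _ : Fintype κ := fs.fintype
  let b := Module.finBasis ℝ E
  let e := fun k : κ => trivializationAt E (TangentSpace I : M → Type _) (fs.c k)
  let S : M → ℝ := fun x => ∑ k, fs k x ^ 2
  have hfsm : ∀ k, ContMDiff I 𝓘(ℝ, ℝ) ∞ (fs k) := fun k => (fs k).contMDiff
  have hS : ContMDiff I 𝓘(ℝ, ℝ) ∞ S :=
    contMDiff_finsetSum (t := Finset.univ) (fun k _ => (hfsm k).pow 2)
  have hSpos : ∀ x, S x ≠ 0 := by
    intro x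
    have h1 : fs (fs.ind x trivial) x ^ 2 ≤ S x :=
      Finset.single_le_sum (f := fun k => fs k x ^ 2) (fun k _ => sq_nonneg _)
        (Finset.mem_univ (fs.ind x trivial))
    rw [fs.apply_ind x trivial] at h1
    have : 0 < S x := lt_of_lt_of_le (by norm_num) h1
    exact this.ne'
  have hYs : ∀ (k : κ) j, ContMDiff I (I.prod 𝓘(ℝ, E)) ∞
      (fun x => (⟨x, fs k x • (e k).localFrame b j x⟩ : TotalSpace E (TangentSpace I : M → Type _))) := by
    intro k j
    exact ContMDiffOn.smul_section_of_tsupport (hfsm k).contMDiffOn (e k).open_baseSet (hfs k)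
      ((e k).contMDiffOn_localFrame_baseSet ∞ b j)
  let Y : κ × Fin (Module.finrank ℝ E) → Cₛ^∞⟮I; E, (TangentSpace I : M → Type _)⟯ :=
    fun p => ⟨fun x => fs p.1 x • (e p.1).localFrame b p.2 x, hYs p.1 p.2⟩
  let θ : κ × Fin (Module.finrank ℝ E) → ∀ x : M, TangentSpace I x →ₗ[ℝ] ℝ :=
    fun p x => (fs p.1 x / S x) • (e p.1).localFrameCoeff I b p.2 x
  have hθ : ∀ p, ContMDiff I.tangent 𝓘(ℝ, ℝ) ∞ (fun q : TangentBundle I M => θ p q.1 q.2) := by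
    rintro ⟨k, j⟩ q
    by_cases hq : q.1 ∈ (e k).baseSet
    · have hsrc : q ∈ (e k).source := (e k).mem_source.2 hq
      have h1 : ContMDiffAt I.tangent 𝓘(ℝ, E) ∞ (fun q : TangentBundle I M => (e k q).2) q :=
        (((e k).contMDiffAt_iff (f := id) (IM := I.tangent) (n := ∞) hsrc).1 contMDiffAt_id).2
      have h2 : ContMDiffAt I.tangent 𝓘(ℝ, ℝ) ∞
          (fun q : TangentBundle I M => b.repr (e k q).2 j) q := by
        have h3 : ContDiff ℝ ∞ (fun v : E => b.repr v j) :=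
          (LinearMap.toContinuousLinearMap (b.coord j)).contDiff
        exact h3.contMDiff.contMDiffAt.comp q h1
      have hp : ContMDiff I.tangent I ∞ (fun q : TangentBundle I M => q.1) :=
        contMDiff_proj (TangentSpace I : M → Type _)
      have h4 : ContMDiffAt I.tangent 𝓘(ℝ, ℝ) ∞
          (fun q : TangentBundle I M => fs k q.1 / S q.1) q :=
        (((hfsm k).div₀ hS hSpos).comp hp) q
      refine (h4.mul h2).congr_of_eventuallyEq ?_
      filter_upwards [(e k).open_source.mem_nhds hsrc] with r hr
      have := (e k).localFrameCoeff_eq_coeff (I := I) (b := b) (s := fun _ => r.2)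
        ((e k).mem_source.1 hr) (i := j)
      change (fs k r.1 / S r.1) * (e k).localFrameCoeff I b j r.1 r.2 = _
      rw [this]
      rfl
    · have hq' : q.1 ∉ tsupport (fs k) := fun h => hq (hfs k h)
      refine (contMDiffAt_const (c := (0 : ℝ))).congr_of_eventuallyEq ?_
      have hc : Continuous (fun q : TangentBundle I M => q.1) :=
        FiberBundle.continuous_proj E (TangentSpace I : M → Type _)
      filter_upwards [hc.continuousAt.preimage_mem_nhds
        ((isClosed_tsupport (fs k)).isOpen_compl.mem_nhds hq')] with r hr
      have : fs k r.1 = 0 := image_eq_zero_of_notMem_tsupport hr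
      change (fs k r.1 / S r.1) * (e k).localFrameCoeff I b j r.1 r.2 = 0
      rw [this]; simp
  have hsum : ∀ (x : M) (v : TangentSpace I x), ∑ p, θ p x v • Y p x = v := by
    intro x v
    rw [Fintype.sum_prod_type]
    have h : ∀ k, ∑ j, θ (k, j) x v • Y (k, j) x = (fs k x ^ 2 / S x) • v := by
      intro k
      by_cases hx : x ∈ (e k).baseSet
      · have h0 := (e k).eq_sum_localFrameCoeff_smul (I := I) (b := b) (s := fun _ => v) hx
        conv_rhs => rw [h0, Finset.smul_sum]
        refine Finset.sum_congr rfl fun j _ => ?_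
        change ((fs k x / S x) * (e k).localFrameCoeff I b j x v) •
          (fs k x • (e k).localFrame b j x) = _
        rw [smul_smul, smul_smul]
        congr 1
        ring
      · have hx' : fs k x = 0 := image_eq_zero_of_notMem_tsupport fun h => hx (hfs k h)
        rw [hx']
        simp only [ne_eq, OfNat.ofNat_ne_zero, not_false_eq_true, zero_pow, zero_div, zero_smul]
        refine Finset.sum_eq_zero fun j _ => ?_
        change ((fs k x / S x) * (e k).localFrameCoeff I b j x v) •
          (fs k x • (e k).localFrame b j x) = _
        rw [hx', zero_div, zero_mul, zero_smul]
    rw [Finset.sum_congr rfl fun k _ => h k, ← Finset.sum_smul, ← Finset.sum_div,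
      div_self (hSpos x), one_smul]
  let eqv := Fintype.equivFin (κ × Fin (Module.finrank ℝ E))
  refine ⟨_, fun i => Y (eqv.symm i), fun i => θ (eqv.symm i), fun i => hθ _, fun x v => ?_⟩
  exact (Equiv.sum_comp eqv.symm (fun p => θ p x v • Y p x)).trans (hsum x v)

section Differential

variable {EM : Type*} [NormedAddCommGroup EM] [NormedSpace ℝ EM]
  {HM : Type*} [TopologicalSpace HM] {IM : ModelWithCorners ℝ EM HM}
  {M : Type*} [TopologicalSpace M] [ChartedSpace HM M] [IsManifold IM ∞ M]
  {EB : Type*} [NormedAddCommGroup EB] [NormedSpace ℝ EB]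
  {HB : Type*} [TopologicalSpace HB] {IB : ModelWithCorners ℝ EB HB}
  {B : Type*} [TopologicalSpace B] [ChartedSpace HB B] [IsManifold IB ∞ B]

/-- `C^∞(M)` as an algebra over `C^∞(B)`, through `f ↦ f ∘ pr`. -/
@[reducible]
def pullbackAlgebra (pr : C^∞⟮IM, M; IB, B⟯) : Algebra (SmoothC IB B) (SmoothC IM M) :=
  RingHom.toAlgebra
    { toFun := fun f => f.comp pr
      map_one' := rfl
      map_mul' := fun _ _ => rfl
      map_zero' := rfl
      map_add' := fun _ _ => rfl }

theorem pullback_starModule (pr : C^∞⟮IM, M; IB, B⟯) :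
    letI := pullbackAlgebra pr
    StarModule (SmoothC IB B) (SmoothC IM M) :=
  letI := pullbackAlgebra pr
  ⟨fun f g => by
    rw [Algebra.smul_def, Algebra.smul_def, star_mul']
    rfl⟩

/-- The value at `x` of an element of `C^∞(M) ⊗_{C^∞(B)} 𝒳(B)`, regarded as a complex vector field
along `pr`; real and imaginary parts. -/
def evalAlong (pr : C^∞⟮IM, M; IB, B⟯) (x : M) :
    letI := pullbackAlgebra pr
    (SmoothC IM M ⊗[SmoothC IB B] ComplexVectorField IB B) →+
      TangentSpace IB (pr x) × TangentSpace IB (pr x) :=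
  letI := pullbackAlgebra pr
  TensorProduct.liftAddHom
    { toFun := fun f =>
        { toFun := fun Y => ((f x).re • Y.re (pr x) - (f x).im • Y.im (pr x),
            (f x).re • Y.im (pr x) + (f x).im • Y.re (pr x))
          map_zero' := by
            refine Prod.ext ?_ ?_ <;>
            simp [ComplexVectorField.zero_re_apply, ComplexVectorField.zero_im_apply]
          map_add' := fun Y Z => by
            refine Prod.ext ?_ ?_ <;>
            simp only [ComplexVectorField.add_re_apply, ComplexVectorField.add_im_apply,
              Prod.mk_add_mk] <;> module }
      map_zero' := by
        refine AddMonoidHom.ext fun Y => Prod.ext ?_ ?_ <;> simp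
      map_add' := fun f g => by
        refine AddMonoidHom.ext fun Y => Prod.ext ?_ ?_ <;>
        simp only [AddMonoidHom.coe_mk, ZeroHom.coe_mk, AddMonoidHom.add_apply, Prod.mk_add_mk,
          SmoothC.add_apply, Complex.add_re, Complex.add_im] <;> module }
    (fun a f Y => by
      have h : (a • f) x = a (pr x) * f x := rfl
      refine Prod.ext ?_ ?_ <;>
      simp only [AddMonoidHom.coe_mk, ZeroHom.coe_mk, ComplexVectorField.smul_re_apply,
        ComplexVectorField.smul_im_apply, h, Complex.mul_re, Complex.mul_im] <;> module)

theorem evalAlong_tmul (pr : C^∞⟮IM, M; IB, B⟯) (x : M) (f : SmoothC IM M)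
    (Y : ComplexVectorField IB B) :
    letI := pullbackAlgebra pr
    evalAlong pr x (f ⊗ₜ[SmoothC IB B] Y) =
      ((f x).re • Y.re (pr x) - (f x).im • Y.im (pr x),
        (f x).re • Y.im (pr x) + (f x).im • Y.re (pr x)) :=
  rfl

/-- The function `x ↦ θ (d pr_x (X x))` for a smooth 1-form `θ` on `B`. -/
def coframeCoeff (pr : C^∞⟮IM, M; IB, B⟯) (θ : ∀ b : B, TangentSpace IB b →ₗ[ℝ] ℝ)
    (hθ : ContMDiff IB.tangent 𝓘(ℝ, ℝ) ∞ (fun p : TangentBundle IB B => θ p.1 p.2)) :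
    ComplexVectorField IM M →ₗ[SmoothC IM M] SmoothC IM M where
  toFun X :=
    have h : ∀ Z : Cₛ^∞⟮IM; EM, (TangentSpace IM : M → Type _)⟯,
        ContMDiff IM 𝓘(ℝ, ℝ) ∞ (fun x => θ (pr x) (mfderiv IM IB pr x (Z x))) := fun Z =>
      hθ.comp ((pr.contMDiff.contMDiff_tangentMap (m := ∞) le_rfl).comp Z.contMDiff)
    SmoothC.mk' _ _ (h X.re) (h X.im)
  map_add' X Z := by
    refine ContMDiffMap.ext fun x => Complex.ext ?_ ?_
    · change θ (pr x) (mfderiv IM IB pr x (X.re x + Z.re x)) =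
        θ (pr x) (mfderiv IM IB pr x (X.re x)) + θ (pr x) (mfderiv IM IB pr x (Z.re x))
      rw [map_add, map_add]
    · change θ (pr x) (mfderiv IM IB pr x (X.im x + Z.im x)) =
        θ (pr x) (mfderiv IM IB pr x (X.im x)) + θ (pr x) (mfderiv IM IB pr x (Z.im x))
      rw [map_add, map_add]
  map_smul' f X := by
    refine ContMDiffMap.ext fun x => Complex.ext ?_ ?_
    · change θ (pr x) (mfderiv IM IB pr x ((f x).re • X.re x - (f x).im • X.im x)) =
        (f x).re * θ (pr x) (mfderiv IM IB pr x (X.re x)) -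
          (f x).im * θ (pr x) (mfderiv IM IB pr x (X.im x))
      simp only [map_sub, map_smul, smul_eq_mul]
    · change θ (pr x) (mfderiv IM IB pr x ((f x).re • X.im x + (f x).im • X.re x)) =
        (f x).re * θ (pr x) (mfderiv IM IB pr x (X.im x)) +
          (f x).im * θ (pr x) (mfderiv IM IB pr x (X.re x))
      simp only [map_add, map_smul, smul_eq_mul]

theorem evalAlong_injective [FiniteDimensional ℝ EB] [T2Space B] [CompactSpace B]
    (pr : C^∞⟮IM, M; IB, B⟯) :
    letI := pullbackAlgebra pr
    ∀ t : SmoothC IM M ⊗[SmoothC IB B] ComplexVectorField IB B,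
      (∀ x, evalAlong pr x t = 0) → t = 0 := by
  let _ := pullbackAlgebra pr
  intro t ht
  obtain ⟨k, Y, θ, hθ, hsum⟩ := exists_tangent_frame IB B
  let cB : Fin k → ComplexVectorField IB B →ₗ[SmoothC IB B] SmoothC IB B := fun i =>
    coframeCoeff ContMDiffMap.id (θ i) (hθ i)
  have hid : ∀ b : B, mfderiv IB IB (ContMDiffMap.id : C^∞⟮IB, B; IB, B⟯) b =
      ContinuousLinearMap.id ℝ (TangentSpace IB b) := fun b => mfderiv_id
  have hre : ∀ i Z b, (cB i Z b).re = θ i b (Z.re b) := fun i Z b => by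
    change θ i b (mfderiv IB IB (ContMDiffMap.id : C^∞⟮IB, B; IB, B⟯) b (Z.re b)) = _
    rw [hid b]; rfl
  have him : ∀ i Z b, (cB i Z b).im = θ i b (Z.im b) := fun i Z b => by
    change θ i b (mfderiv IB IB (ContMDiffMap.id : C^∞⟮IB, B; IB, B⟯) b (Z.im b)) = _
    rw [hid b]; rfl
  let Yc : Fin k → ComplexVectorField IB B := fun i => ⟨Y i, 0⟩
  have hZ : ∀ Z, Z = ∑ i, cB i Z • Yc i := by
    intro Z
    have hsre : ∀ b, (∑ i, cB i Z • Yc i).re b = ∑ i, (cB i Z • Yc i).re b := fun b =>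
      map_sum ({ toFun := fun X => X.re b, map_zero' := rfl, map_add' := fun _ _ => rfl } :
        ComplexVectorField IB B →+ TangentSpace IB b) _ _
    have hsim : ∀ b, (∑ i, cB i Z • Yc i).im b = ∑ i, (cB i Z • Yc i).im b := fun b =>
      map_sum ({ toFun := fun X => X.im b, map_zero' := rfl, map_add' := fun _ _ => rfl } :
        ComplexVectorField IB B →+ TangentSpace IB b) _ _
    have h0 : ∀ i b, (Yc i).im b = 0 := fun _ _ => rfl
    refine ComplexVectorField.ext_apply (fun b => ?_) (fun b => ?_)
    · rw [hsre]
      simp only [ComplexVectorField.smul_re_apply, h0, smul_zero, sub_zero, hre]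
      exact (hsum b _).symm
    · rw [hsim]
      simp only [ComplexVectorField.smul_im_apply, h0, smul_zero, zero_add, him]
      exact (hsum b _).symm
  let c : Fin k → (SmoothC IM M ⊗[SmoothC IB B] ComplexVectorField IB B) →ₗ[SmoothC IM M]
      SmoothC IM M := fun i =>
    LinearMap.liftBaseChange (SmoothC IM M) ((Algebra.linearMap _ _).comp (cB i))
  have h1 : ∀ t, t = ∑ i, c i t ⊗ₜ Yc i := by
    intro t
    induction t using TensorProduct.induction_on with
    | zero => simp
    | tmul f Z =>
      conv_lhs => rw [hZ Z, TensorProduct.tmul_sum]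
      refine Finset.sum_congr rfl fun i _ => ?_
      rw [TensorProduct.tmul_smul, TensorProduct.smul_tmul']
      congr 1
      simp only [c, LinearMap.liftBaseChange_tmul, LinearMap.comp_apply, Algebra.linearMap_apply,
        Algebra.smul_def]
      exact mul_comm _ _
    | add t u ht hu =>
      simp only [map_add, TensorProduct.add_tmul, Finset.sum_add_distrib]
      rw [← ht, ← hu]
  have h2 : ∀ i t x, c i t x =
      ⟨θ i (pr x) (evalAlong pr x t).1, θ i (pr x) (evalAlong pr x t).2⟩ := by
    intro i t x
    induction t using TensorProduct.induction_on with
    | zero =>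
      simp only [map_zero, Prod.fst_zero, Prod.snd_zero]
      rfl
    | tmul f Z =>
      rw [evalAlong_tmul]
      have : c i (f ⊗ₜ Z) x = f x * cB i Z (pr x) := rfl
      rw [this]
      refine Complex.ext ?_ ?_
      · simp only [Complex.mul_re, hre, him, map_sub, map_smul, smul_eq_mul]
      · simp only [Complex.mul_im, hre, him, map_add, map_smul, smul_eq_mul]
    | add t u ht hu =>
      rw [map_add, SmoothC.add_apply, ht, hu]
      refine Complex.ext ?_ ?_ <;>
      simp only [map_add, Prod.fst_add, Prod.snd_add, Complex.add_re, Complex.add_im]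
  rw [h1 t]
  refine Finset.sum_eq_zero fun i _ => ?_
  have : c i t = 0 := by
    refine ContMDiffMap.ext fun x => ?_
    rw [h2, ht]
    simp only [Prod.fst_zero, Prod.snd_zero, map_zero]
    rfl
  rw [this, TensorProduct.zero_tmul]

theorem exists_differential [FiniteDimensional ℝ EB] [T2Space B] [CompactSpace B]
    (pr : C^∞⟮IM, M; IB, B⟯) :
    letI := pullbackAlgebra pr
    ∃ D : ComplexVectorField IM M →ₗ[SmoothC IM M]
        (SmoothC IM M ⊗[SmoothC IB B] ComplexVectorField IB B),
      ∀ X x, evalAlong pr x (D X) =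
        (mfderiv IM IB pr x (X.re x), mfderiv IM IB pr x (X.im x)) := by
  let _ := pullbackAlgebra pr
  obtain ⟨k, Y, θ, hθ, hsum⟩ := exists_tangent_frame IB B
  let Yc : Fin k → ComplexVectorField IB B := fun i => ⟨Y i, 0⟩
  let D : ComplexVectorField IM M →ₗ[SmoothC IM M]
      (SmoothC IM M ⊗[SmoothC IB B] ComplexVectorField IB B) :=
    ∑ i, ((TensorProduct.AlgebraTensorModule.mk (SmoothC IB B) (SmoothC IM M) (SmoothC IM M)
      (ComplexVectorField IB B)).flip (Yc i)).comp (coframeCoeff pr (θ i) (hθ i))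
  refine ⟨D, fun X x => ?_⟩
  have hD : D X = ∑ i, coframeCoeff pr (θ i) (hθ i) X ⊗ₜ Yc i := by
    simp only [D, LinearMap.sum_apply]
    rfl
  rw [hD, map_sum]
  have hterm : ∀ i, evalAlong pr x (coframeCoeff pr (θ i) (hθ i) X ⊗ₜ Yc i) =
      (θ i (pr x) (mfderiv IM IB pr x (X.re x)) • Y i (pr x),
        θ i (pr x) (mfderiv IM IB pr x (X.im x)) • Y i (pr x)) := by
    intro i
    rw [evalAlong_tmul]
    have h0 : (Yc i).im (pr x) = 0 := rfl
    rw [h0, smul_zero, smul_zero, sub_zero, zero_add]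
    rfl
  rw [Finset.sum_congr rfl fun i _ => hterm i]
  refine Prod.ext ?_ ?_
  · rw [Prod.fst_sum]
    exact hsum (pr x) _
  · rw [Prod.snd_sum]
    exact hsum (pr x) _

/-- The differential of a smooth map `pr : M → B`, as the `C^∞(M)`-linear map
`𝒳(M) → C^∞(M) ⊗_{C^∞(B)} 𝒳(B)`: it is the unique linear map with
`(differential X)(x) = d pr_x (X x)` for all `x`
(see `differential_spec` and `evalAlong_injective`). -/
def differential [FiniteDimensional ℝ EB] [T2Space B] [CompactSpace B]
    (pr : C^∞⟮IM, M; IB, B⟯) :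
    letI := pullbackAlgebra pr
    ComplexVectorField IM M →ₗ[SmoothC IM M]
      (SmoothC IM M ⊗[SmoothC IB B] ComplexVectorField IB B) :=
  (exists_differential pr).choose

theorem differential_spec [FiniteDimensional ℝ EB] [T2Space B] [CompactSpace B]
    (pr : C^∞⟮IM, M; IB, B⟯) (X : ComplexVectorField IM M) (x : M) :
    evalAlong pr x (differential pr X) =
      (mfderiv IM IB pr x (X.re x), mfderiv IM IB pr x (X.im x)) :=
  (exists_differential pr).choose_spec X x

theorem conj_mem_vertical [FiniteDimensional ℝ EB] [T2Space B] [CompactSpace B]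
    (pr : C^∞⟮IM, M; IB, B⟯) (X : ComplexVectorField IM M)
    (hX : X ∈ LinearMap.ker (differential pr)) :
    ComplexVectorField.conj X ∈ LinearMap.ker (differential pr) := by
  rw [LinearMap.mem_ker] at hX ⊢
  refine evalAlong_injective pr _ fun x => ?_
  have h := differential_spec pr X x
  rw [hX, map_zero] at h
  rw [differential_spec]
  have h1 : mfderiv IM IB pr x (X.re x) = 0 := (congrArg Prod.fst h).symm
  have h2 : mfderiv IM IB pr x (X.im x) = 0 := (congrArg Prod.snd h).symm
  rw [ComplexVectorField.conj_re_apply, ComplexVectorField.conj_im_apply, map_neg, h1, h2,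
    neg_zero]
  rfl

section RiemannianSubmersion

variable [RiemannianBundle (fun x : M => TangentSpace IM x)]
  [IsContMDiffRiemannianBundle IM ∞ EM (fun x : M => TangentSpace IM x)]
  [FiniteDimensional ℝ EB] [T2Space B] [CompactSpace B]

/-- `pr : M → B` is a Riemannian submersion: its differential `𝒳(M) → C^∞(M) ⊗ 𝒳(B)` is surjective
and restricts to an isometric isomorphism on the orthogonal complement of its kernel. -/
def IsRiemannianSubmersion [RiemannianBundle (fun x : B => TangentSpace IB x)]
    [IsContMDiffRiemannianBundle IB ∞ EB (fun x : B => TangentSpace IB x)]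
    (pr : C^∞⟮IM, M; IB, B⟯) : Prop :=
  letI := pullbackAlgebra pr
  IsRiemannianDifferential (vectorFieldMetric IM M) (vectorFieldMetric IB B) (differential pr)

/-- The metric on the complex vertical vector fields `𝒳_V(M) = ker (d pr)`, that is, on the sections
of the complexified vertical tangent bundle. -/
def verticalMetric (pr : C^∞⟮IM, M; IB, B⟯) :
    ComplexMetric (SmoothC IM M) (LinearMap.ker (differential pr)) :=
  (vectorFieldMetric IM M).restrict _ (conj_mem_vertical pr)

/-- A K-orientation of the submersion `pr : M → B` with underlying module `F` of sections: a
(smooth, `ℤ/2`-graded) spin^c structure on the vertical tangent bundle `ker (d pr)`, given by a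
spinor module for the complex Clifford algebra of the vertical tangent bundle. -/
abbrev KOrientation (pr : C^∞⟮IM, M; IB, B⟯)
    (F : Type*) [AddCommGroup F] [Module (SmoothC IM M) F] : Type _ :=
  SpinorModule (verticalMetric pr) F

end RiemannianSubmersion

end Differential

end Geometry

end VertClif

end

open VertClif

noncomputable section
namespace VertClif

/-! ### Finite projective modules: dual bases and rank-one operators. -/

section DualBasis

variable {R P : Type*} [CommRing R] [AddCommGroup P] [Module R P]

/-! The proof is Morita theory combined with the splitting of the Clifford algebra into its
horizontal and vertical parts.

Write R = C^∞(M). Base change turns `Cl(B) ≅ End(E_B)` into an isomorphism `Cl_H ≅ End_R(E_H)`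
(`horizontalAction_bijective`). The module E_H is finitely generated projective, and it is a
generator: composing a linear functional on `Cl_H` that sends 1 to 1 with a dual basis gives ∑
φ_j(p_j) = 1 (`exists_sum_dual_eq_one`). Hence E_V = E_H^* ⊗ E_M satisfies E_H ⊗ E_V ≅ E_M through
`contract`, p ⊗ (φ ⊗ s) ↦ (|p⟩φ)s. The isomorphism is not formed explicitly. What is used is that
contractions span E_M (`exists_eq_sum_contract`) and that φ ⊗ (p·v) = φ(p)v (`verticalMk_contract`).

Let w ∈ `Cl_H` be the element acting as γ_H. It is even with w² = 1 and anticommutes with horizontal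
vectors. So X ↦ wX, for vertical X, extends to a homomorphism j from Cl(ker dπ) into the commutant
of `Cl_H`, and a ⊗ u ↦ a j(u) maps the ordinary tensor product `Cl_H` ⊗ Cl(ker dπ) onto `Cl(M)`.
Under the contraction, 1 ⊗ c_V(u) becomes c(j(u)) (`contract_verticalAction`). Injectivity of c_V
follows from that of j and c. For surjectivity, an operator 1 ⊗ S on E_M comes from some ∑ a j(u),
and pairing E_H away with the φ_j and p_j turns this sum into an element of the image of c_V. Since
j and the inclusion of vertical vectors differ only by w on the odd part, the subalgebra `Cl_V` is
itself Cl(ker dπ) (`verticalInclusion_injective`).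

The hermitian form h on E_V is determined by ⟨q·u, p·v⟩ = ⟨q,p⟩ h(u,v) (`exists_vertical_form`).
Since finitely many ⟨q_j,p_j⟩ sum to 1, an identity over R may be checked after multiplication by
all ⟨q,p⟩. Symmetry, non-degeneracy and adjoint relations thus descend from E_M. Positivity needs
the pointwise order: over every point of M some ⟨s,s⟩ is strictly positive
(`nonneg_of_form_mul_nonneg`). -/

theorem exists_dual_basis (R P : Type*) [CommRing R] [AddCommGroup P] [Module R P]
    [Module.Finite R P] [Module.Projective R P] :
    ∃ (n : ℕ) (e : Fin n → P) (e' : Fin n → Module.Dual R P), ∀ p, ∑ i, e' i p • e i = p := by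
  obtain ⟨n, f, g, -, -, hfg⟩ := Module.Finite.exists_comp_eq_id_of_projective R P
  refine ⟨n, fun i => f (Pi.single i 1), fun i => (LinearMap.proj i).comp g, fun p => ?_⟩
  have h := LinearMap.congr_fun hfg p
  rw [LinearMap.comp_apply, ← Finset.univ_sum_single (g p), map_sum] at h
  refine Eq.trans (Finset.sum_congr rfl fun i _ => ?_) h
  rw [← map_smul, LinearMap.comp_apply, LinearMap.proj_apply, ← Pi.single_smul, smul_eq_mul,
    mul_one]

/-- In bra-ket form, T|p⟩φ = |Tp⟩φ. -/
theorem mul_smulRight (T : Module.End R P) (p : P) (φ : Module.Dual R P) :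
    T * φ.smulRight p = φ.smulRight (T p) := by
  ext z
  simp

end DualBasis

/-! ### Endomorphisms of a finite projective module commute with base change. -/

section EndBaseChange

variable (A R E : Type*) [CommRing A] [CommRing R] [Algebra A R] [AddCommGroup E] [Module A E]

/-- The canonical map `R ⊗ End_A(E) → End_R(R ⊗ E)`. -/
def endBaseChange : R ⊗[A] Module.End A E →ₐ[R] Module.End R (R ⊗[A] E) :=
  Algebra.TensorProduct.lift (Algebra.ofId R _) (Module.End.baseChangeHom A R E)
    (fun r _ => Algebra.commutes r _)

variable {A R E} in
theorem endBaseChange_tmul (r : R) (T : Module.End A E) (f : R) (s : E) :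
    endBaseChange A R E (r ⊗ₜ T) (f ⊗ₜ s) = (r * f) ⊗ₜ T s := by
  simp [endBaseChange, Algebra.ofId_apply, Module.End.baseChangeHom, LinearMap.baseChangeHom,
    TensorProduct.smul_tmul']

/-- A dual basis provides matrix units, and the inverse records the matrix entries of an operator on
the base-changed module. -/
theorem endBaseChange_bijective [Module.Finite A E] [Module.Projective A E] :
    Function.Bijective (endBaseChange A R E) := by
  obtain ⟨n, e, e', he⟩ := exists_dual_basis A E
  let c : Fin n → Module.Dual R (R ⊗[A] E) := fun j =>
    LinearMap.liftBaseChange R ((Algebra.linearMap A R).comp (e' j))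
  have hc : ∀ j f s, c j (f ⊗ₜ s) = f * algebraMap A R (e' j s) := fun j f s => by
    simp [c]
  -- The (j, i) entry of T is the j-th coordinate of T(1 ⊗ e_i); the matrix unit beside it is
  -- already defined over A.
  let inv : Module.End R (R ⊗[A] E) → R ⊗[A] Module.End A E := fun T =>
    ∑ i, ∑ j, c j (T (1 ⊗ₜ e i)) ⊗ₜ (e' i).smulRight (e j)
  have hsum : ∀ z, ∑ j, c j z ⊗ₜ[A] e j = z := by
    intro z
    induction z using TensorProduct.induction_on with
    | zero => simp
    | add z w hz hw => simp only [map_add, TensorProduct.add_tmul, Finset.sum_add_distrib, hz, hw]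
    | tmul f s =>
      conv_rhs => rw [← he s, TensorProduct.tmul_sum]
      refine Finset.sum_congr rfl fun j _ => ?_
      rw [hc, TensorProduct.tmul_smul, TensorProduct.smul_tmul', Algebra.smul_def, mul_comm]
  refine Function.bijective_iff_has_inverse.2 ⟨inv, fun t => ?_, fun T => ?_⟩
  · induction t using TensorProduct.induction_on with
    | zero => simp [inv]
    | add t u ht hu =>
      simp only [inv, map_add, LinearMap.add_apply, TensorProduct.add_tmul,
        Finset.sum_add_distrib] at ht hu ⊢
      rw [ht, hu]
    | tmul r S =>
      have hS : S = ∑ i, ∑ j, e' j (S (e i)) • (e' i).smulRight (e j) := by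
        refine LinearMap.ext fun s => ?_
        conv_lhs => rw [← he s]
        simp only [map_sum, map_smul, LinearMap.sum_apply, LinearMap.smul_apply,
          LinearMap.smulRight_apply]
        refine Finset.sum_congr rfl fun i _ => ?_
        conv_lhs => rw [← he (S (e i)), Finset.smul_sum]
        exact Finset.sum_congr rfl fun j _ => smul_comm _ _ _
      conv_rhs => rw [hS]
      simp only [TensorProduct.tmul_sum, inv]
      refine Finset.sum_congr rfl fun i _ => Finset.sum_congr rfl fun j _ => ?_
      rw [endBaseChange_tmul, hc, TensorProduct.tmul_smul, TensorProduct.smul_tmul',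
        Algebra.smul_def, mul_one, mul_comm]
  · refine TensorProduct.AlgebraTensorModule.ext fun f s => ?_
    simp only [inv, map_sum, LinearMap.sum_apply, endBaseChange_tmul, LinearMap.smulRight_apply]
    have h1 : T (f ⊗ₜ s) = f • T (1 ⊗ₜ s) := by
      rw [← map_smul, TensorProduct.smul_tmul', smul_eq_mul, mul_one]
    have h2 : (1 : R) ⊗ₜ[A] s = ∑ i, algebraMap A R (e' i s) • ((1 : R) ⊗ₜ[A] e i) := by
      conv_lhs => rw [← he s, TensorProduct.tmul_sum]
      simp only [TensorProduct.tmul_smul, algebraMap_smul]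
    rw [h1, h2, map_sum, Finset.smul_sum]
    refine Finset.sum_congr rfl fun i _ => ?_
    rw [map_smul]
    conv_rhs => rw [← hsum (T (1 ⊗ₜ e i)), Finset.smul_sum, Finset.smul_sum]
    refine Finset.sum_congr rfl fun j _ => ?_
    simp only [TensorProduct.tmul_smul, TensorProduct.smul_tmul', smul_eq_mul, Algebra.smul_def]
    congr 1
    ring

end EndBaseChange

/-! ### A unital functional on the Clifford algebra. -/

section CliffordTrace

/-- The Clifford algebra has an `R`-linear functional with value `1` at `1`. -/
theorem exists_clifford_functional {R V : Type*} [CommRing R] [AddCommGroup V] [Module R V]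
    [Invertible (2 : R)] (Q : QuadraticForm R V) :
    ∃ τ : CliffordAlgebra Q →ₗ[R] R, τ 1 = 1 := by
  -- With 2 invertible, the Clifford algebra is linearly the exterior algebra; the functional is the
  -- projection to degree zero.
  refine ⟨ExteriorAlgebra.algebraMapInv.toLinearMap.comp
    (CliffordAlgebra.equivExterior Q).toLinearMap, ?_⟩
  have h : CliffordAlgebra.equivExterior Q 1 = 1 := 
    CliffordAlgebra.changeForm_one CliffordAlgebra.changeForm.associated_neg_proof
  change ExteriorAlgebra.algebraMapInv (CliffordAlgebra.equivExterior Q 1) = 1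
  rw [h, map_one]

end CliffordTrace

/-! ### The horizontal Clifford algebra is the endomorphism algebra of E_H. -/

section Submersion

variable {A R W V : Type*} [CommRing A] [StarRing A] [PartialOrder A]
  [CommRing R] [StarRing R] [PartialOrder R] [Algebra A R]
  [AddCommGroup W] [Module A W] [AddCommGroup V] [Module R V]
  {gV : ComplexMetric R V} {gW : ComplexMetric A W} {D : V →ₗ[R] R ⊗[A] W}
  {EB : Type*} [AddCommGroup EB] [Module A EB]
  {EM : Type*} [AddCommGroup EM] [Module R EM]

theorem quadratic_baseChange [Invertible (2 : A)] [Invertible (2 : R)] (gW : ComplexMetric A W)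
    (t : R ⊗[A] W) : gW.quadratic.baseChange R t = gW.bilin.baseChange R t t := by
  have h : QuadraticMap.associated gW.quadratic = gW.bilin :=
    QuadraticMap.associated_left_inverse A (fun X Y => gW.symm X Y)
  have h2 := QuadraticForm.associated_baseChange (A := R) gW.quadratic
  rw [h] at h2
  rw [← h2, QuadraticMap.associated_eq_self_apply]

/-- The action factors as `Cl_H` ≅ Cl(R ⊗ W) ≅ R ⊗ Cl(W) ≅ R ⊗ End(E_B) ≅ End(R ⊗ E_B): the isometry
D, base change of Clifford algebras, the spinor isomorphism of the base, and base change of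
endomorphisms. -/
theorem horizontalAction_bijective [Invertible (2 : A)] [Invertible (2 : R)]
    (hD : IsRiemannianDifferential gV gW D) (SB : SpinorModule gW EB) :
    Function.Bijective (horizontalAction hD SB) := by
  have := SB.finite
  have := SB.projective
  let eD : (horizontalForm gV D).IsometryEquiv (gW.quadratic.baseChange R) :=
    { LinearEquiv.ofBijective _ hD.bijective with
      map_app' := fun X => by
        refine (quadratic_baseChange gW (D X)).trans ?_
        exact hD.isometry X X.2 X X.2 }
  let E : HorizontalClifford gV D ≃ₐ[R] R ⊗[A] Module.End A EB :=
    (CliffordAlgebra.equivOfIsometry eD).trans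
      ((CliffordAlgebra.equivBaseChange R gW.quadratic).trans
        (Algebra.TensorProduct.congr AlgEquiv.refl SB.c))
  -- Both sides are algebra homomorphisms, so agreement on vectors suffices.
  have h : horizontalAction hD SB = (endBaseChange A R EB).comp E.toAlgHom := by
    refine CliffordAlgebra.hom_ext (LinearMap.ext fun X => ?_)
    have h1 : ∀ t : R ⊗[A] W, pulledClifford R SB t = endBaseChange A R EB
        (Algebra.TensorProduct.congr (AlgEquiv.refl (R := R)) SB.c
          (CliffordAlgebra.toBaseChange R gW.quadratic (CliffordAlgebra.ι _ t))) := by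
      intro t
      induction t using TensorProduct.induction_on with
      | zero => simp
      | add t u ht hu => simp only [map_add, ht, hu]
      | tmul f Y =>
        rw [CliffordAlgebra.toBaseChange_ι]
        refine end_pullback_ext fun k s => ?_
        rw [pulledClifford_tmul, Algebra.TensorProduct.congr_apply,
          Algebra.TensorProduct.map_tmul, endBaseChange_tmul]
        rfl
    have h2 : CliffordAlgebra.equivOfIsometry eD (CliffordAlgebra.ι _ X) =
        CliffordAlgebra.ι _ (D X) := CliffordAlgebra.map_apply_ι _ _
    change horizontalAction hD SB (CliffordAlgebra.ι _ X) = endBaseChange A R EB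
      (Algebra.TensorProduct.congr AlgEquiv.refl SB.c
        (CliffordAlgebra.equivBaseChange R gW.quadratic
          (CliffordAlgebra.equivOfIsometry eD (CliffordAlgebra.ι _ X))))
    rw [horizontalAction_ι, h1, h2]
    rfl
  rw [h]
  exact (endBaseChange_bijective A R EB).comp E.bijective

end Submersion

/-! ### Maps out of the balanced tensor product. -/

namespace BalancedTensor

variable {R P N C Q : Type*} [CommRing R] [AddCommGroup P] [Module R P] [AddCommGroup N]
  [Module R N] [AddCommGroup Q] [Module R Q]

/-- The elementary tensor as a bilinear map. -/
def mkBilin (ρ : C → Module.End R P) (l : C → Module.End R N) :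
    P →ₗ[R] N →ₗ[R] BalancedTensor ρ l :=
  (TensorProduct.mk R P N).compr₂ (balancedRelations ρ l).mkQ

variable {ρ : C → Module.End R P} {l : C → Module.End R N}

theorem mkBilin_balanced (p : P) (a : C) (s : N) :
    mkBilin ρ l (ρ a p) s = mkBilin ρ l p (l a s) :=
  (Submodule.Quotient.eq _).2 (Submodule.subset_span ⟨p, a, s, rfl⟩)

theorem induction_on {motive : BalancedTensor ρ l → Prop} (z : BalancedTensor ρ l)
    (mkBilin : ∀ p s, motive (mkBilin ρ l p s)) (add : ∀ z w, motive z → motive w → motive (z + w)) :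
    motive z := by
  obtain ⟨t, rfl⟩ := (balancedRelations ρ l).mkQ_surjective z
  induction t using TensorProduct.induction_on with
  | zero =>
    -- Zero is itself an elementary tensor, so the induction principle needs no separate zero case.
    have h := mkBilin 0 0
    rw [map_zero] at h ⊢
    exact h
  | tmul p s => exact mkBilin p s
  | add t u ht hu => rw [map_add]; exact add _ _ ht hu

theorem hom_ext {f g : BalancedTensor ρ l →ₗ[R] Q}
    (h : ∀ p s, f (mkBilin ρ l p s) = g (mkBilin ρ l p s)) : f = g := by
  refine LinearMap.ext fun z => ?_
  induction z using induction_on with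
  | mkBilin p s => exact h p s
  | add z w hz hw => rw [map_add, map_add, hz, hw]

/-- The linear map on `P ⊗_C N` induced by a balanced bilinear map. -/
def lift (f : P →ₗ[R] N →ₗ[R] Q) (hf : ∀ p a s, f (ρ a p) s = f p (l a s)) :
    BalancedTensor ρ l →ₗ[R] Q :=
  (balancedRelations ρ l).liftQ (TensorProduct.lift f) (by
    refine Submodule.span_le.2 ?_
    rintro _ ⟨p, a, s, rfl⟩
    simp [hf])

theorem lift_mkBilin (f : P →ₗ[R] N →ₗ[R] Q) (hf : ∀ p a s, f (ρ a p) s = f p (l a s))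
    (p : P) (s : N) : lift f hf (mkBilin ρ l p s) = f p s := by
  change TensorProduct.lift f (p ⊗ₜ s) = f p s
  rw [TensorProduct.lift.tmul]

end BalancedTensor

section Submersion

variable {A R W V : Type*} [CommRing A] [StarRing A] [PartialOrder A]
  [CommRing R] [StarRing R] [PartialOrder R] [Algebra A R]
  [AddCommGroup W] [Module A W] [AddCommGroup V] [Module R V]
  {gV : ComplexMetric R V} {gW : ComplexMetric A W} {D : V →ₗ[R] R ⊗[A] W}
  {EB : Type*} [AddCommGroup EB] [Module A EB]
  {EM : Type*} [AddCommGroup EM] [Module R EM]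

/-! ### The pulled back hermitian form on E_H. -/

section HorizontalForm

variable [StarModule A R]

theorem pulledHermitian_tmul (SB : SpinorModule gW EB) (f g : R) (s t : EB) :
    pulledHermitian R SB (f ⊗ₜ s) (g ⊗ₜ t) = star f * algebraMap A R (SB.herm.form s t) * g :=
  sesqBaseChange_tmul _ _ _ _ _

theorem star_pulledHermitian (SB : SpinorModule gW EB) (ξ η : R ⊗[A] EB) :
    star (pulledHermitian R SB ξ η) = pulledHermitian R SB η ξ := by
  induction ξ using TensorProduct.induction_on with
  | zero => simp
  | add ξ ξ' h h' => simp only [map_add, LinearMap.add_apply, star_add, h, h']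
  | tmul f s =>
    induction η using TensorProduct.induction_on with
    | zero => simp
    | add ξ ξ' h h' => simp only [map_add, LinearMap.add_apply, star_add, h, h']
    | tmul g t =>
      rw [pulledHermitian_tmul, pulledHermitian_tmul, star_mul', star_mul', star_star,
        ← algebraMap_star_comm, SB.herm.star_form]
      ring

/-- The coordinates of a dual basis of E_B are bras by non-degeneracy over the base, and a
functional on R ⊗ E_B is determined by its values on the basis vectors. -/
theorem pulledHermitian_surjective (SB : SpinorModule gW EB) (φ : Module.Dual R (R ⊗[A] EB)) :
    ∃ ξ, pulledHermitian R SB ξ = φ := by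
  have := SB.finite
  have := SB.projective
  obtain ⟨n, e, e', he⟩ := exists_dual_basis A EB
  choose f hf using fun i => SB.herm.perfect.2 (e' i)
  -- The coefficients are conjugated because the form is conjugate linear in its first variable.
  refine ⟨∑ i, star (φ (1 ⊗ₜ e i)) ⊗ₜ f i, TensorProduct.AlgebraTensorModule.ext fun g s => ?_⟩
  have hf' : ∀ i, SB.herm.form (f i) s = e' i s := fun i => LinearMap.congr_fun (hf i) s
  have hs : g ⊗ₜ[A] s = ∑ i, (algebraMap A R (e' i s) * g) • ((1 : R) ⊗ₜ[A] e i) := by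
    conv_lhs => rw [← he s, TensorProduct.tmul_sum]
    refine Finset.sum_congr rfl fun i _ => ?_
    rw [TensorProduct.tmul_smul, TensorProduct.smul_tmul', TensorProduct.smul_tmul',
      Algebra.smul_def, smul_eq_mul, mul_one]
  rw [map_sum, LinearMap.sum_apply]
  conv_rhs => rw [hs, map_sum]
  refine Finset.sum_congr rfl fun i _ => ?_
  rw [pulledHermitian_tmul, star_star, hf', map_smul, smul_eq_mul]
  ring

/-- Every coordinate functional is a bra, so all coordinates of ξ vanish. -/
theorem pulledHermitian_separating (SB : SpinorModule gW EB) {ξ : R ⊗[A] EB}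
    (h : ∀ η, pulledHermitian R SB η ξ = 0) : ξ = 0 := by
  have := SB.finite
  have := SB.projective
  obtain ⟨n, e, e', he⟩ := exists_dual_basis R (R ⊗[A] EB)
  rw [← he ξ]
  refine Finset.sum_eq_zero fun i _ => ?_
  obtain ⟨η, hη⟩ := pulledHermitian_surjective SB (e' i)
  rw [← hη, h, zero_smul]

theorem pulledHermitian_grading (SB : SpinorModule gW EB) (ξ η : R ⊗[A] EB) :
    pulledHermitian R SB (horizontalGrading R SB ξ) η =
      pulledHermitian R SB ξ (horizontalGrading R SB η) := by
  induction ξ using TensorProduct.induction_on with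
  | zero => simp
  | add ξ ξ' h h' => simp only [map_add, LinearMap.add_apply, h, h']
  | tmul f s =>
    induction η using TensorProduct.induction_on with
    | zero => simp
    | add ξ ξ' h h' => simp only [map_add, h, h']
    | tmul g t =>
      simp only [horizontalGrading, LinearMap.baseChange_tmul, pulledHermitian_tmul,
        SB.γ_selfAdjoint]

end HorizontalForm

variable [Invertible (2 : A)] [Invertible (2 : R)]

/-- The horizontal Clifford action as an isomorphism `Cl_H ≃ End(E_H)`. -/
def horizontalEquiv (hD : IsRiemannianDifferential gV gW D) (SB : SpinorModule gW EB) :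
    HorizontalClifford gV D ≃ₐ[R] Module.End R (R ⊗[A] EB) :=
  AlgEquiv.ofBijective _ (horizontalAction_bijective hD SB)

/-- The spinor module `E_H` is a generator: its trace ideal is all of `R`. -/
theorem exists_sum_dual_eq_one (hD : IsRiemannianDifferential gV gW D)
    (SB : SpinorModule gW EB) :
    ∃ (n : ℕ) (p : Fin n → R ⊗[A] EB) (φ : Fin n → Module.Dual R (R ⊗[A] EB)),
      ∑ j, φ j (p j) = 1 := by
  have := SB.finite
  have := SB.projective
  obtain ⟨n, e, e', he⟩ := exists_dual_basis R (R ⊗[A] EB)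
  obtain ⟨τ, hτ⟩ := exists_clifford_functional (horizontalForm gV D)
  -- Evaluating σ on 1 = ∑ |e_i⟩e'_i gives ∑ φ_i(e_i) = σ(1) = 1 for φ_i = σ(|·⟩e'_i).
  let σ : Module.End R (R ⊗[A] EB) →ₗ[R] R :=
    τ.comp (horizontalEquiv hD SB).symm.toLinearMap
  refine ⟨n, e, fun i => σ.comp (LinearMap.smulRightₗ (e' i)), ?_⟩
  have h1 : ∑ i, (e' i).smulRight (e i) = (1 : Module.End R (R ⊗[A] EB)) :=
    LinearMap.ext fun z => by simp [he]
  have h2 : σ 1 = 1 := by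
    change τ ((horizontalEquiv hD SB).symm 1) = 1
    rw [map_one, hτ]
  rw [← h2, ← h1, map_sum]
  rfl

/-- The action of `End(E_H)` on `E_M` through the horizontal Clifford algebra. -/
def horizontalRep (hD : IsRiemannianDifferential gV gW D) (SB : SpinorModule gW EB)
    (SM : SpinorModule gV EM) : Module.End R (R ⊗[A] EB) →ₐ[R] Module.End R EM :=
  SM.c.toAlgHom.comp ((horizontalInclusion gV D).comp (horizontalEquiv hD SB).symm.toAlgHom)

theorem horizontalRep_action (hD : IsRiemannianDifferential gV gW D) (SB : SpinorModule gW EB)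
    (SM : SpinorModule gV EM) (a : HorizontalClifford gV D) :
    horizontalRep hD SB SM (horizontalAction hD SB a) = SM.c (horizontalInclusion gV D a) := by
  change SM.c (horizontalInclusion gV D ((horizontalEquiv hD SB).symm (horizontalEquiv hD SB a))) = _
  rw [AlgEquiv.symm_apply_apply]

/-- An operator on `E_M` that commutes with `Cl_H` up to the grading commutes with `End(E_H)` up to
conjugation by `γ_H`. -/
theorem twisted_horizontalRep (hD : IsRiemannianDifferential gV gW D) (SB : SpinorModule gW EB)
    (SM : SpinorModule gV EM) {S : Module.End R EM}
    (hS : ∀ a, S * SM.c (horizontalInclusion gV D a) =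
      SM.c (horizontalInclusion gV D (CliffordAlgebra.involute a)) * S)
    (T : Module.End R (R ⊗[A] EB)) :
    S * horizontalRep hD SB SM T = horizontalRep hD SB SM
      (horizontalGrading R SB * T * horizontalGrading R SB) * S := by
  obtain ⟨a, rfl⟩ := (horizontalAction_bijective hD SB).2 T
  have h : horizontalGrading R SB * horizontalAction hD SB a * horizontalGrading R SB =
      horizontalAction hD SB (CliffordAlgebra.involute a) := by
    rw [mul_assoc, horizontalAction_involute, ← mul_assoc, horizontalGrading_sq, one_mul]
  rw [h, horizontalRep_action, horizontalRep_action, hS]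

/-! ### Morita theory: E_M as the product of E_H and E_V. -/

section Morita

variable (hD : IsRiemannianDifferential gV gW D) (SB : SpinorModule gW EB)
  (SM : SpinorModule gV EM)

/-- The elementary tensors of `E_V = E_H^* ⊗ E_M`. -/
abbrev verticalMk : Module.Dual R (R ⊗[A] EB) →ₗ[R] EM →ₗ[R] VerticalSpinor hD SB SM :=
  BalancedTensor.mkBilin _ _

/-- As c_H is onto End(E_H), the tensor product is balanced over the whole endomorphism algebra, in
particular over rank-one operators. -/
theorem verticalMk_comp (φ : Module.Dual R (R ⊗[A] EB)) (T : Module.End R (R ⊗[A] EB)) (s : EM) :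
    verticalMk hD SB SM (φ.comp T) s = verticalMk hD SB SM φ (horizontalRep hD SB SM T s) := by
  obtain ⟨a, rfl⟩ := (horizontalAction_bijective hD SB).2 T
  rw [horizontalRep_action]
  exact BalancedTensor.mkBilin_balanced φ a s

/-- Since |p⟩(φ ∘ c_H(a)) = (|p⟩φ) c_H(a), the contraction with p descends to the quotient E_V. -/
theorem horizontalRep_smulRight_balanced (p : R ⊗[A] EB) (φ : Module.Dual R (R ⊗[A] EB))
    (a : HorizontalClifford gV D) (s : EM) :
    (horizontalRep hD SB SM).toLinearMap.comp (LinearMap.smulRightₗ.flip p)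
        ((horizontalAction hD SB a).dualMap φ) s =
      (horizontalRep hD SB SM).toLinearMap.comp (LinearMap.smulRightₗ.flip p) φ
        (SM.c (horizontalInclusion gV D a) s) := by
  have h : LinearMap.smulRightₗ (φ.comp (horizontalAction hD SB a)) p =
      (LinearMap.smulRightₗ φ p : Module.End R _) * horizontalAction hD SB a := rfl
  change horizontalRep hD SB SM
    (LinearMap.smulRightₗ (φ.comp (horizontalAction hD SB a)) p) s = _
  rw [h, map_mul, horizontalRep_action]
  rfl

/-- The contraction `E_H ⊗ E_V → E_M`, `p ⊗ (φ ⊗ s) ↦ (|p⟩φ) s`. -/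
def contract : (R ⊗[A] EB) →ₗ[R] VerticalSpinor hD SB SM →ₗ[R] EM where
  toFun p := BalancedTensor.lift
    ((horizontalRep hD SB SM).toLinearMap.comp (LinearMap.smulRightₗ.flip p))
    (horizontalRep_smulRight_balanced hD SB SM p)
  map_add' p q := BalancedTensor.hom_ext fun φ s => by
    simp only [BalancedTensor.lift_mkBilin, LinearMap.add_apply, LinearMap.comp_apply, map_add]
  map_smul' r p := BalancedTensor.hom_ext fun φ s => by
    simp only [BalancedTensor.lift_mkBilin, LinearMap.smul_apply, LinearMap.comp_apply, map_smul,
      RingHom.id_apply]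

theorem contract_mk (p : R ⊗[A] EB) (φ : Module.Dual R (R ⊗[A] EB)) (s : EM) :
    contract hD SB SM p (verticalMk hD SB SM φ s) = horizontalRep hD SB SM (φ.smulRight p) s :=
  BalancedTensor.lift_mkBilin _ (horizontalRep_smulRight_balanced hD SB SM p) _ _

/-- Moving |p⟩ψ across the balanced tensor sign gives φ ∘ |p⟩ψ = φ(p)ψ. This is the identity that
undoes a contraction. -/
theorem verticalMk_contract (φ : Module.Dual R (R ⊗[A] EB)) (p : R ⊗[A] EB)
    (v : VerticalSpinor hD SB SM) :
    verticalMk hD SB SM φ (contract hD SB SM p v) = φ p • v := by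
  induction v using BalancedTensor.induction_on with
  | add v w hv hw => rw [map_add, map_add, smul_add, hv, hw]
  | mkBilin ψ s =>
    rw [contract_mk, ← verticalMk_comp]
    have h : φ.comp (ψ.smulRight p) = φ p • ψ := LinearMap.ext fun z => by simp [mul_comm]
    rw [h, map_smul, LinearMap.smul_apply]

/-- Under the contraction, End(E_H) acts on the factor E_H alone. -/
theorem horizontalRep_contract (T : Module.End R (R ⊗[A] EB)) (p : R ⊗[A] EB)
    (v : VerticalSpinor hD SB SM) :
    horizontalRep hD SB SM T (contract hD SB SM p v) = contract hD SB SM (T p) v := by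
  induction v using BalancedTensor.induction_on with
  | add v w hv hw => simp only [map_add, hv, hw]
  | mkBilin ψ s =>
    rw [contract_mk, contract_mk, ← Module.End.mul_apply, ← map_mul, mul_smulRight]

/-- The contraction `E_H ⊗ E_V → E_M` is surjective. -/
theorem exists_eq_sum_contract : ∃ (n : ℕ) (e : Fin n → R ⊗[A] EB)
    (e' : Fin n → Module.Dual R (R ⊗[A] EB)), (∀ p, ∑ i, e' i p • e i = p) ∧
    ∀ s, ∑ i, contract hD SB SM (e i) (verticalMk hD SB SM (e' i) s) = s := by
  have := SB.finite
  have := SB.projective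
  obtain ⟨n, e, e', he⟩ := exists_dual_basis R (R ⊗[A] EB)
  refine ⟨n, e, e', he, fun s => ?_⟩
  have h1 : ∑ i, (e' i).smulRight (e i) = (1 : Module.End R (R ⊗[A] EB)) :=
    LinearMap.ext fun z => by simp [he]
  simp only [contract_mk]
  rw [← LinearMap.sum_apply, ← map_sum, h1, map_one, Module.End.one_apply]

/-- Because E_H is a generator, v = ∑ φ_j(p_j) v = ∑ φ_j ⊗ (p_j·v). -/
theorem eq_zero_of_contract_eq_zero {v : VerticalSpinor hD SB SM}
    (h : ∀ p, contract hD SB SM p v = 0) : v = 0 := by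
  obtain ⟨n, p, φ, hφ⟩ := exists_sum_dual_eq_one hD SB
  rw [← one_smul R v, ← hφ, Finset.sum_smul]
  refine Finset.sum_eq_zero fun j _ => ?_
  rw [← verticalMk_contract, h, map_zero]

theorem linearMap_ext_contract {N : Type*} [AddCommGroup N] [Module R N] {f g : EM →ₗ[R] N}
    (h : ∀ p v, f (contract hD SB SM p v) = g (contract hD SB SM p v)) : f = g := by
  obtain ⟨n, e, e', -, hs⟩ := exists_eq_sum_contract hD SB SM
  refine LinearMap.ext fun s => ?_
  rw [← hs s, map_sum, map_sum]
  exact Finset.sum_congr rfl fun i _ => h _ _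

/-- The relation ∑ φ_j(p_j) = 1 exhibits E_V as a direct summand of a finite power of E_M. -/
theorem verticalSpinor_finite_projective :
    Module.Finite R (VerticalSpinor hD SB SM) ∧ Module.Projective R (VerticalSpinor hD SB SM) := by
  have := SM.finite
  have := SM.projective
  obtain ⟨n, p, φ, hφ⟩ := exists_sum_dual_eq_one hD SB
  let i : VerticalSpinor hD SB SM →ₗ[R] (Fin n → EM) := LinearMap.pi fun j => contract hD SB SM (p j)
  let r : (Fin n → EM) →ₗ[R] VerticalSpinor hD SB SM :=
    ∑ j, (verticalMk hD SB SM (φ j)).comp (LinearMap.proj j)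
  have h : r.comp i = LinearMap.id := LinearMap.ext fun v => by
    change r (i v) = v
    simp only [r, i, LinearMap.sum_apply, LinearMap.comp_apply, LinearMap.proj_apply,
      LinearMap.pi_apply, verticalMk_contract]
    rw [← Finset.sum_smul, hφ, one_smul]
  have : Module.Projective R (Fin n → EM) :=
    Module.Projective.of_equiv (DFinsupp.linearEquivFunOnFintype (R := R) (M := fun _ => EM))
  exact ⟨Module.Finite.of_surjective r (LinearMap.surjective_of_comp_eq_id _ _ h),
    Module.Projective.of_split i r h⟩

/-- The operator `γ_H^* ⊗ S` on `E_V`, in terms of the contraction. -/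
theorem contract_twistedMap {S : Module.End R EM}
    (hS : ∀ a, S * SM.c (horizontalInclusion gV D a) =
      SM.c (horizontalInclusion gV D (CliffordAlgebra.involute a)) * S)
    (p : R ⊗[A] EB) (v : VerticalSpinor hD SB SM) :
    contract hD SB SM p (BalancedTensor.twistedMap CliffordAlgebra.involute
        (horizontalGrading R SB).dualMap S (dualGrading_comm hD SB) hS v) =
      S (contract hD SB SM (horizontalGrading R SB p) v) := by
  induction v using BalancedTensor.induction_on with
  | add v w hv hw => simp only [map_add, hv, hw]
  | mkBilin φ s =>
    have h1 : BalancedTensor.twistedMap CliffordAlgebra.involute (horizontalGrading R SB).dualMap S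
        (dualGrading_comm hD SB) hS (verticalMk hD SB SM φ s) =
        verticalMk hD SB SM (φ.comp (horizontalGrading R SB)) (S s) := rfl
    have h2 := LinearMap.congr_fun (twisted_horizontalRep hD SB SM hS
      (φ.smulRight (horizontalGrading R SB p))) s
    -- By γ_H² = 1, conjugating |γ_H p⟩φ by γ_H moves the grading from the ket to the functional.
    have h3 : horizontalGrading R SB * φ.smulRight (horizontalGrading R SB p) *
        horizontalGrading R SB = (φ.comp (horizontalGrading R SB)).smulRight p := by
      rw [mul_smulRight, ← Module.End.mul_apply, horizontalGrading_sq]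
      rfl
    rw [h3] at h2
    erw [h1]
    rw [contract_mk, contract_mk]
    exact h2.symm

end Morita

end Submersion

section Submersion

variable {A R W V : Type*} [CommRing A] [StarRing A] [PartialOrder A]
  [CommRing R] [StarRing R] [PartialOrder R] [Algebra A R]
  [AddCommGroup W] [Module A W] [AddCommGroup V] [Module R V]
  {gV : ComplexMetric R V} {gW : ComplexMetric A W} {D : V →ₗ[R] R ⊗[A] W}
  {EB : Type*} [AddCommGroup EB] [Module A EB]
  {EM : Type*} [AddCommGroup EM] [Module R EM]

/-! ### Orthogonal splitting into horizontal and vertical vectors. -/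

section Decomposition

variable (hD : IsRiemannianDifferential gV gW D)

/-- The horizontal component of a vector. -/
def horizontalPart : V →ₗ[R] horizontal gV D :=
  (LinearEquiv.ofBijective _ hD.bijective).symm.toLinearMap.comp D

theorem differential_horizontalPart (X : V) : D (horizontalPart hD X) = D X :=
  (LinearEquiv.ofBijective _ hD.bijective).apply_symm_apply (D X)

theorem horizontalPart_of_mem_horizontal (X : horizontal gV D) : horizontalPart hD X = X :=
  hD.bijective.1 (differential_horizontalPart hD X)

/-- The vertical component of a vector. -/
def verticalPart : V →ₗ[R] LinearMap.ker D :=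
  (LinearMap.id - (horizontal gV D).subtype.comp (horizontalPart hD)).codRestrict _ fun X => by
    rw [LinearMap.mem_ker, LinearMap.sub_apply, map_sub]
    exact sub_eq_zero.2 (differential_horizontalPart hD X).symm

theorem coe_verticalPart (X : V) : (verticalPart hD X : V) = X - horizontalPart hD X := rfl

theorem horizontalPart_add_verticalPart (X : V) :
    (horizontalPart hD X : V) + verticalPart hD X = X := by
  rw [coe_verticalPart, add_sub_cancel]

theorem horizontalPart_of_mem_vertical (X : LinearMap.ker D) : horizontalPart hD (X : V) = 0 := by
  refine hD.bijective.1 ?_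
  rw [map_zero]
  exact (differential_horizontalPart hD X).trans X.2

theorem verticalPart_of_mem_vertical (X : LinearMap.ker D) : verticalPart hD (X : V) = X := by
  refine Subtype.ext ?_
  rw [coe_verticalPart, horizontalPart_of_mem_vertical, ZeroMemClass.coe_zero, sub_zero]

theorem verticalPart_of_mem_horizontal (X : horizontal gV D) : verticalPart hD (X : V) = 0 := by
  refine Subtype.ext ?_
  rw [coe_verticalPart, horizontalPart_of_mem_horizontal, sub_self, ZeroMemClass.coe_zero]

/-- The cross terms vanish because horizontal vectors are orthogonal to the kernel by definition. -/
theorem bilin_self_eq_add (X : V) : gV.bilin X X =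
    gV.bilin (horizontalPart hD X : V) (horizontalPart hD X) +
      gV.bilin (verticalPart hD X : V) (verticalPart hD X) := by
  have h0 : gV.bilin (verticalPart hD X : V) (horizontalPart hD X : V) = 0 :=
    (horizontalPart hD X).2 _ (verticalPart hD X).2
  have h1 : gV.bilin (horizontalPart hD X : V) (verticalPart hD X : V) = 0 := by
    rw [gV.symm, h0]
  conv_lhs => rw [← horizontalPart_add_verticalPart hD X]
  simp only [map_add, LinearMap.add_apply, h0, h1]
  ring

end Decomposition

/-! ### The Clifford algebra of the vertical vectors inside the full one. -/

section VerticalInclusion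

variable (hker : ∀ X ∈ LinearMap.ker D, gV.conj X ∈ LinearMap.ker D)

/-- The map from the Clifford algebra of the vertical vectors to the Clifford algebra. -/
def verticalInclusion : (gV.restrict _ hker).Cl →ₐ[R] gV.Cl :=
  CliffordAlgebra.map ⟨(LinearMap.ker D).subtype, fun _ => rfl⟩

theorem verticalInclusion_ι (X : LinearMap.ker D) :
    verticalInclusion hker ((gV.restrict _ hker).ι X) = gV.ι X :=
  CliffordAlgebra.map_apply_ι _ _

theorem verticalInclusion_involute (u : (gV.restrict _ hker).Cl) :
    verticalInclusion hker (CliffordAlgebra.involute u) =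
      CliffordAlgebra.involute (verticalInclusion hker u) := by
  induction u using CliffordAlgebra.induction with
  | algebraMap r => simp only [AlgHom.commutes]
  | ι X =>
    rw [CliffordAlgebra.involute_ι, map_neg, verticalInclusion_ι, CliffordAlgebra.involute_ι]
  | mul a b ha hb => simp only [map_mul, ha, hb]
  | add a b ha hb => simp only [map_add, ha, hb]

theorem verticalInclusion_cstar (u : (gV.restrict _ hker).Cl) :
    verticalInclusion hker ((gV.restrict _ hker).cstar u) =
      gV.cstar (verticalInclusion hker u) := by
  induction u using CliffordAlgebra.induction with
  | algebraMap r => simp only [AlgHom.commutes, ComplexMetric.cstar_algebraMap]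
  | ι X =>
    rw [ComplexMetric.cstar_ι, verticalInclusion_ι, verticalInclusion_ι, ComplexMetric.cstar_ι]
    rfl
  | mul a b ha hb => simp only [map_mul, ComplexMetric.cstar_mul, ha, hb]
  | add a b ha hb => simp only [map_add, ComplexMetric.cstar_add, ha, hb]

end VerticalInclusion

variable [Invertible (2 : A)] [Invertible (2 : R)]

/-! ### The chirality element w of the horizontal Clifford algebra. -/

section Chirality

variable (hD : IsRiemannianDifferential gV gW D) (SB : SpinorModule gW EB)

/-- The element of the horizontal Clifford algebra that acts as the grading `γ_H`. -/
def chirality : HorizontalClifford gV D := (horizontalEquiv hD SB).symm (horizontalGrading R SB)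

theorem horizontalAction_chirality :
    horizontalAction hD SB (chirality hD SB) = horizontalGrading R SB :=
  (horizontalEquiv hD SB).apply_symm_apply _

theorem chirality_sq : chirality hD SB * chirality hD SB = 1 := by
  refine (horizontalAction_bijective hD SB).1 ?_
  rw [map_mul, horizontalAction_chirality, horizontalGrading_sq, map_one]

/-- On E_H the grading automorphism is conjugation by γ_H, and c_H is faithful. -/
theorem mul_chirality (a : HorizontalClifford gV D) :
    a * chirality hD SB = chirality hD SB * CliffordAlgebra.involute a := by
  refine (horizontalAction_bijective hD SB).1 ?_
  rw [map_mul, map_mul, horizontalAction_chirality, horizontalAction_involute]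

/-- Apply `mul_chirality` to w itself and cancel one factor w. -/
theorem involute_chirality : CliffordAlgebra.involute (chirality hD SB) = chirality hD SB := by
  have h := mul_chirality hD SB (chirality hD SB)
  have h2 := congrArg (chirality hD SB * ·) h
  simp only [← mul_assoc, chirality_sq, one_mul, mul_one] at h2
  exact h2.symm

theorem ι_mul_chirality (Y : horizontal gV D) :
    CliffordAlgebra.ι _ Y * chirality hD SB = -(chirality hD SB * CliffordAlgebra.ι _ Y) := by
  rw [mul_chirality, CliffordAlgebra.involute_ι, mul_neg]

/-- As w is even, moving a vertical vector past it costs no sign. -/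
theorem vertical_mul_chirality (X : LinearMap.ker D) :
    gV.ι X * horizontalInclusion gV D (chirality hD SB) =
      horizontalInclusion gV D (chirality hD SB) * gV.ι X := by
  rw [vertical_mul_horizontal, involute_chirality]

theorem inclusion_chirality_sq : horizontalInclusion gV D (chirality hD SB) *
    horizontalInclusion gV D (chirality hD SB) = 1 := by
  rw [← map_mul, chirality_sq, map_one]

end Chirality

/-! ### Factorization of the Clifford algebra into commuting subalgebras. -/

section VerticalClifford

variable (hD : IsRiemannianDifferential gV gW D) (SB : SpinorModule gW EB)
  (hker : ∀ X ∈ LinearMap.ker D, gV.conj X ∈ LinearMap.ker D)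

/-- The homomorphism from the Clifford algebra of the vertical vectors to the commutant of the
horizontal Clifford algebra that multiplies vertical vectors by the chirality element. -/
def twistedInclusion : (gV.restrict _ hker).Cl →ₐ[R] gV.Cl :=
  CliffordAlgebra.lift _
    ⟨(LinearMap.mulLeft R (horizontalInclusion gV D (chirality hD SB))).comp
      (gV.ι.comp (LinearMap.ker D).subtype), fun X => by
      change horizontalInclusion gV D (chirality hD SB) * gV.ι X *
        (horizontalInclusion gV D (chirality hD SB) * gV.ι X) = _
      -- Since w commutes with X and w² = 1, (wX)² = X².
      rw [mul_assoc, ← mul_assoc (gV.ι X), vertical_mul_chirality, mul_assoc, ← mul_assoc,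
        inclusion_chirality_sq, one_mul, CliffordAlgebra.ι_sq_scalar]
      rfl⟩

theorem twistedInclusion_ι (X : LinearMap.ker D) :
    twistedInclusion hD SB hker ((gV.restrict _ hker).ι X) =
      horizontalInclusion gV D (chirality hD SB) * gV.ι X :=
  CliffordAlgebra.lift_ι_apply _ _ _

/-- Both w and a vertical vector anticommute with horizontal vectors, so their product commutes with
them. This replaces the graded tensor product by the ordinary one. -/
theorem horizontal_commute_twistedInclusion (a : HorizontalClifford gV D)
    (u : (gV.restrict _ hker).Cl) :
    Commute (horizontalInclusion gV D a) (twistedInclusion hD SB hker u) := by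
  induction u using CliffordAlgebra.induction with
  | algebraMap r => rw [AlgHom.commutes]; exact (Algebra.commutes r _).symm
  | ι X =>
    rw [Commute, SemiconjBy, twistedInclusion_ι, mul_assoc, vertical_mul_horizontal, ← mul_assoc,
      ← mul_assoc, ← map_mul, ← map_mul, mul_chirality]
  | mul u v hu hv => rw [map_mul]; exact hu.mul_right hv
  | add u v hu hv => rw [map_add]; exact hu.add_right hv

/-- The multiplication map `Cl_H ⊗ Cl(ker D) → Cl`. -/
def cliffordFactorization :
    HorizontalClifford gV D ⊗[R] (gV.restrict _ hker).Cl →ₐ[R] gV.Cl :=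
  Algebra.TensorProduct.lift (horizontalInclusion gV D) (twistedInclusion hD SB hker)
    (horizontal_commute_twistedInclusion hD SB hker)

theorem cliffordFactorization_tmul (a : HorizontalClifford gV D) (u : (gV.restrict _ hker).Cl) :
    cliffordFactorization hD SB hker (a ⊗ₜ u) =
      horizontalInclusion gV D a * twistedInclusion hD SB hker u :=
  Algebra.TensorProduct.lift_tmul _ _ _ _ _

theorem cliffordFactorization_surjective :
    Function.Surjective (cliffordFactorization hD SB hker) := by
  rw [← AlgHom.range_eq_top, ← top_le_iff, ← CliffordAlgebra.adjoin_range_ι, Algebra.adjoin_le_iff]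
  rintro _ ⟨X, rfl⟩
  -- The vertical component is recovered as X_V = w(wX_V).
  refine ⟨CliffordAlgebra.ι _ (horizontalPart hD X) ⊗ₜ 1 +
    chirality hD SB ⊗ₜ (gV.restrict _ hker).ι (verticalPart hD X), ?_⟩
  change cliffordFactorization hD SB hker _ = _
  rw [map_add, cliffordFactorization_tmul, cliffordFactorization_tmul, map_one, mul_one,
    twistedInclusion_ι, ← mul_assoc, inclusion_chirality_sq, one_mul]
  have h : horizontalInclusion gV D (CliffordAlgebra.ι _ (horizontalPart hD X)) =
      gV.ι (horizontalPart hD X) := CliffordAlgebra.map_apply_ι _ _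
  rw [h, ← map_add, horizontalPart_add_verticalPart]

/-- The inverse of the multiplication map `Cl_H ⊗ Cl(ker D) → Cl`. -/
def cliffordSplit : gV.Cl →ₐ[R] HorizontalClifford gV D ⊗[R] (gV.restrict _ hker).Cl :=
  CliffordAlgebra.lift _
    ⟨((TensorProduct.mk R (HorizontalClifford gV D) (gV.restrict _ hker).Cl).flip 1).comp
        ((CliffordAlgebra.ι _).comp (horizontalPart hD)) +
      (TensorProduct.mk R (HorizontalClifford gV D) (gV.restrict _ hker).Cl
        (chirality hD SB)).comp ((gV.restrict _ hker).ι.comp (verticalPart hD)), fun X => by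
      change (CliffordAlgebra.ι _ (horizontalPart hD X) ⊗ₜ[R] (1 : (gV.restrict _ hker).Cl) +
          chirality hD SB ⊗ₜ[R] (gV.restrict _ hker).ι (verticalPart hD X)) *
        (CliffordAlgebra.ι _ (horizontalPart hD X) ⊗ₜ[R] (1 : (gV.restrict _ hker).Cl) +
          chirality hD SB ⊗ₜ[R] (gV.restrict _ hker).ι (verticalPart hD X)) = _
      have hq : gV.quadratic X = horizontalForm gV D (horizontalPart hD X) +
        (gV.restrict _ hker).quadratic (verticalPart hD X) := bilin_self_eq_add hD X
      -- The cross terms add up to (X_H w + w X_H) ⊗ X_V = 0, leaving the two squares.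
      simp only [mul_add, add_mul, Algebra.TensorProduct.tmul_mul_tmul, mul_one, one_mul,
        CliffordAlgebra.ι_sq_scalar, chirality_sq, ι_mul_chirality, hq, map_add]
      rw [TensorProduct.neg_tmul, Algebra.TensorProduct.algebraMap_apply,
        Algebra.TensorProduct.algebraMap_apply']
      abel⟩

theorem cliffordSplit_ι (X : V) : cliffordSplit hD SB hker (gV.ι X) =
    CliffordAlgebra.ι _ (horizontalPart hD X) ⊗ₜ[R] (1 : (gV.restrict _ hker).Cl) +
      chirality hD SB ⊗ₜ[R] (gV.restrict _ hker).ι (verticalPart hD X) :=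
  CliffordAlgebra.lift_ι_apply _ _ _

theorem cliffordSplit_horizontalInclusion (a : HorizontalClifford gV D) :
    cliffordSplit hD SB hker (horizontalInclusion gV D a) = a ⊗ₜ 1 := by
  induction a using CliffordAlgebra.induction with
  | algebraMap r =>
    rw [AlgHom.commutes, AlgHom.commutes, Algebra.TensorProduct.algebraMap_apply]
  | ι X =>
    have h : horizontalInclusion gV D (CliffordAlgebra.ι _ X) = gV.ι X :=
      CliffordAlgebra.map_apply_ι _ _
    rw [h, cliffordSplit_ι, horizontalPart_of_mem_horizontal, verticalPart_of_mem_horizontal,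
      map_zero, TensorProduct.tmul_zero, add_zero]
  | mul a b ha hb =>
    rw [map_mul, map_mul, ha, hb, Algebra.TensorProduct.tmul_mul_tmul, mul_one]
  | add a b ha hb => rw [map_add, map_add, ha, hb, TensorProduct.add_tmul]

theorem cliffordSplit_twistedInclusion (u : (gV.restrict _ hker).Cl) :
    cliffordSplit hD SB hker (twistedInclusion hD SB hker u) = 1 ⊗ₜ u := by
  induction u using CliffordAlgebra.induction with
  | algebraMap r =>
    rw [AlgHom.commutes, AlgHom.commutes, Algebra.TensorProduct.algebraMap_apply']
  | ι X =>
    rw [twistedInclusion_ι, map_mul, cliffordSplit_horizontalInclusion, cliffordSplit_ι,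
      horizontalPart_of_mem_vertical, verticalPart_of_mem_vertical, map_zero,
      TensorProduct.zero_tmul, zero_add, Algebra.TensorProduct.tmul_mul_tmul, chirality_sq, one_mul]
  | mul a b ha hb =>
    rw [map_mul, map_mul, ha, hb, Algebra.TensorProduct.tmul_mul_tmul, mul_one]
  | add a b ha hb => rw [map_add, map_add, ha, hb, TensorProduct.tmul_add]

/-- The splitting sends j(u) to 1 ⊗ u, and a functional with value 1 at 1 on the horizontal factor
recovers u. -/
theorem twistedInclusion_injective : Function.Injective (twistedInclusion hD SB hker) := by
  obtain ⟨τ, hτ⟩ := exists_clifford_functional (horizontalForm gV D)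
  refine Function.LeftInverse.injective (g := fun b =>
    TensorProduct.lid R _ (TensorProduct.map τ LinearMap.id (cliffordSplit hD SB hker b)))
    fun u => ?_
  simp only [cliffordSplit_twistedInclusion, TensorProduct.map_tmul, hτ, LinearMap.id_apply,
    TensorProduct.lid_tmul, one_smul]

theorem verticalInclusion_commute_chirality (u : (gV.restrict _ hker).Cl) :
    Commute (verticalInclusion hker u) (horizontalInclusion gV D (chirality hD SB)) := by
  induction u using CliffordAlgebra.induction with
  | algebraMap r => rw [AlgHom.commutes]; exact Algebra.commutes r _
  | ι X => rw [verticalInclusion_ι]; exact vertical_mul_chirality hD SB X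
  | mul u v hu hv => rw [map_mul]; exact hu.mul_left hv
  | add u v hu hv => rw [map_add]; exact hu.add_left hv

/-- On the even part the twisted inclusion is the inclusion, on the odd part it is the inclusion
multiplied by the chirality element. -/
theorem two_smul_twistedInclusion (u : (gV.restrict _ hker).Cl) :
    (2 : R) • twistedInclusion hD SB hker u =
      (1 + horizontalInclusion gV D (chirality hD SB)) * verticalInclusion hker u +
        (1 - horizontalInclusion gV D (chirality hD SB)) *
          verticalInclusion hker (CliffordAlgebra.involute u) := by
  have hw := inclusion_chirality_sq hD SB
  have hc := verticalInclusion_commute_chirality hD SB hker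
  set w := horizontalInclusion gV D (chirality hD SB)
  induction u using CliffordAlgebra.induction with
  | algebraMap r =>
    simp only [AlgHom.commutes, two_smul]
    noncomm_ring
  | ι X =>
    rw [CliffordAlgebra.involute_ι, map_neg, verticalInclusion_ι, twistedInclusion_ι, two_smul]
    noncomm_ring
  | add a b ha hb =>
    simp only [map_add, smul_add, ha, hb]
    noncomm_ring
  | mul a b ha hb =>
    -- The elements (1 ± w)/2 are orthogonal idempotents commuting with the vertical algebra, which
    -- makes the right-hand side, once halved, multiplicative. To avoid halves, the identity is
    -- doubled once more and 2 is cancelled.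
    have h2 : Function.Injective (fun x : gV.Cl => (2 : R) • x) := fun x y h => by
      have := congrArg ((⅟2 : R) • ·) h
      simpa only [smul_smul, invOf_mul_self, one_smul] using this
    refine h2 ?_
    have e1 : (2 : R) • (2 : R) • twistedInclusion hD SB hker (a * b) =
        ((2 : R) • twistedInclusion hD SB hker a) * ((2 : R) • twistedInclusion hD SB hker b) := by
      rw [map_mul, smul_mul_smul_comm, smul_smul]
    change (2 : R) • (2 : R) • twistedInclusion hD SB hker (a * b) = (2 : R) • _
    have ha' := (hc a).eq
    have ha'' := (hc (CliffordAlgebra.involute a)).eq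
    have p1 : ∀ x y : gV.Cl, x * w = w * x →
        (1 + w) * x * ((1 + w) * y) = (2 : R) • ((1 + w) * (x * y)) := fun x y hx => by
      have : (1 + w) * x * ((1 + w) * y) = (1 + w) * (x * y) + (1 + w) * (x * w) * y := by
        noncomm_ring
      rw [this, hx, two_smul]
      have : (1 + w) * (w * x) * y = w * (x * y) + w * w * (x * y) := by noncomm_ring
      rw [this, hw]; noncomm_ring
    have p2 : ∀ x y : gV.Cl, x * w = w * x →
        (1 - w) * x * ((1 - w) * y) = (2 : R) • ((1 - w) * (x * y)) := fun x y hx => by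
      have : (1 - w) * x * ((1 - w) * y) = (1 - w) * (x * y) - (1 - w) * (x * w) * y := by
        noncomm_ring
      rw [this, hx, two_smul]
      have : (1 - w) * (w * x) * y = w * (x * y) - w * w * (x * y) := by noncomm_ring
      rw [this, hw]; noncomm_ring
    have p3 : ∀ x y : gV.Cl, x * w = w * x → (1 + w) * x * ((1 - w) * y) = 0 := fun x y hx => by
      have : (1 + w) * x * ((1 - w) * y) = (1 + w) * (x * y) - (1 + w) * (x * w) * y := by
        noncomm_ring
      rw [this, hx]
      have : (1 + w) * (w * x) * y = w * (x * y) + w * w * (x * y) := by noncomm_ring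
      rw [this, hw]; noncomm_ring
    have p4 : ∀ x y : gV.Cl, x * w = w * x → (1 - w) * x * ((1 + w) * y) = 0 := fun x y hx => by
      have : (1 - w) * x * ((1 + w) * y) = (1 - w) * (x * y) + (1 - w) * (x * w) * y := by
        noncomm_ring
      rw [this, hx]
      have : (1 - w) * (w * x) * y = w * (x * y) - w * w * (x * y) := by noncomm_ring
      rw [this, hw]; noncomm_ring
    rw [e1, ha, hb, add_mul, mul_add, mul_add, p1 _ _ ha', p2 _ _ ha'', p3 _ _ ha', p4 _ _ ha'',
      add_zero, zero_add, map_mul, map_mul, map_mul, smul_add]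

/-- If u maps to zero then so does its involute, and the formula for 2j(u) gives 2j(u) = 0, while j
is injective. -/
theorem verticalInclusion_injective (hD : IsRiemannianDifferential gV gW D)
    (SB : SpinorModule gW EB) : Function.Injective (verticalInclusion hker) := by
  rw [injective_iff_map_eq_zero]
  intro u hu
  have h := two_smul_twistedInclusion hD SB hker u
  rw [verticalInclusion_involute, hu, map_zero, mul_zero, mul_zero, add_zero, ← map_smul] at h
  have h2 := (injective_iff_map_eq_zero _).1 (twistedInclusion_injective hD SB hker) _ h
  rw [← one_smul R u, ← invOf_mul_self (2 : R), mul_smul, h2, smul_zero]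

end VerticalClifford

end Submersion

section Submersion

variable {A R W V : Type*} [CommRing A] [StarRing A] [PartialOrder A]
  [CommRing R] [StarRing R] [PartialOrder R] [Algebra A R]
  [AddCommGroup W] [Module A W] [AddCommGroup V] [Module R V]
  {gV : ComplexMetric R V} {gW : ComplexMetric A W} {D : V →ₗ[R] R ⊗[A] W}
  {EB : Type*} [AddCommGroup EB] [Module A EB]
  {EM : Type*} [AddCommGroup EM] [Module R EM]

/-! ### The vertical Clifford action and its bijectivity. -/

section VerticalAction

variable (hD : IsRiemannianDifferential gV gW D) (SB : SpinorModule gW EB)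
  (SM : SpinorModule gV EM)

theorem verticalCliffordEnd_mk (X : LinearMap.ker D) (φ : Module.Dual R (R ⊗[A] EB)) (s : EM) :
    verticalCliffordEnd hD SB SM X (verticalMk hD SB SM φ s) =
      verticalMk hD SB SM (φ.comp (horizontalGrading R SB)) (SM.c (gV.ι X) s) := rfl

theorem verticalGrading_mk (φ : Module.Dual R (R ⊗[A] EB)) (s : EM) :
    verticalGrading hD SB SM (verticalMk hD SB SM φ s) =
      verticalMk hD SB SM (φ.comp (horizontalGrading R SB)) (SM.γ s) := rfl

theorem comp_grading_grading (φ : Module.Dual R (R ⊗[A] EB)) :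
    (φ.comp (horizontalGrading R SB)).comp (horizontalGrading R SB) = φ := by
  refine LinearMap.ext fun z => ?_
  exact congrArg φ (LinearMap.congr_fun (horizontalGrading_sq SB) z)

theorem verticalGrading_sq : verticalGrading hD SB SM * verticalGrading hD SB SM = 1 := by
  refine BalancedTensor.hom_ext fun φ s => ?_
  have h := LinearMap.congr_fun SM.γ_sq s
  rw [Module.End.mul_apply, Module.End.one_apply] at h
  change verticalGrading hD SB SM (verticalGrading hD SB SM (verticalMk hD SB SM φ s)) =
    verticalMk hD SB SM φ s
  rw [verticalGrading_mk, verticalGrading_mk, comp_grading_grading, h]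

variable (hker : ∀ X ∈ LinearMap.ker D, gV.conj X ∈ LinearMap.ker D)

/-- The vertical Clifford action `c_V` on the Clifford algebra of the vertical vectors. -/
def verticalAction : (gV.restrict _ hker).Cl →ₐ[R] Module.End R (VerticalSpinor hD SB SM) :=
  CliffordAlgebra.lift _
    ⟨{ toFun := verticalCliffordEnd hD SB SM
       map_add' := fun X Y => BalancedTensor.hom_ext fun φ s => by
        rw [LinearMap.add_apply]
        change verticalMk hD SB SM _ (SM.c (gV.ι ((X : V) + Y)) s) =
          verticalMk hD SB SM _ (SM.c (gV.ι X) s) + verticalMk hD SB SM _ (SM.c (gV.ι Y) s)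
        rw [map_add, map_add, LinearMap.add_apply, map_add]
       map_smul' := fun r X => BalancedTensor.hom_ext fun φ s => by
        rw [LinearMap.smul_apply]
        change verticalMk hD SB SM _ (SM.c (gV.ι (r • (X : V))) s) =
          r • verticalMk hD SB SM _ (SM.c (gV.ι X) s)
        rw [map_smul, map_smul, LinearMap.smul_apply, map_smul] },
      fun X => BalancedTensor.hom_ext fun φ s => by
        change verticalCliffordEnd hD SB SM X
          (verticalCliffordEnd hD SB SM X (verticalMk hD SB SM φ s)) =
            gV.bilin (X : V) X • verticalMk hD SB SM φ s
        -- Two factors γ_H^* cancel, leaving c(X)² = ⟨X, X⟩ on E_M.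
        rw [verticalCliffordEnd_mk, verticalCliffordEnd_mk, comp_grading_grading,
          ← Module.End.mul_apply, ← map_mul, CliffordAlgebra.ι_sq_scalar, AlgEquiv.commutes,
          Module.algebraMap_end_apply, map_smul]
        rfl⟩

theorem verticalAction_ι (X : LinearMap.ker D) :
    verticalAction hD SB SM hker ((gV.restrict _ hker).ι X) = verticalCliffordEnd hD SB SM X :=
  CliffordAlgebra.lift_ι_apply _ _ _

theorem verticalCliffordEnd_neg (X : LinearMap.ker D) : -verticalCliffordEnd hD SB SM X =
    verticalGrading hD SB SM * verticalCliffordEnd hD SB SM X * verticalGrading hD SB SM := by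
  refine BalancedTensor.hom_ext fun φ s => ?_
  change -verticalCliffordEnd hD SB SM X (verticalMk hD SB SM φ s) = verticalGrading hD SB SM
    (verticalCliffordEnd hD SB SM X (verticalGrading hD SB SM (verticalMk hD SB SM φ s)))
  rw [verticalGrading_mk, verticalCliffordEnd_mk, verticalCliffordEnd_mk, verticalGrading_mk,
    comp_grading_grading]
  have h := LinearMap.congr_fun (SM.c_involute (gV.ι X)) s
  rw [CliffordAlgebra.involute_ι, map_neg, LinearMap.neg_apply] at h
  change -(SM.c (gV.ι X) s) = SM.γ (SM.c (gV.ι X) (SM.γ s)) at h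
  rw [← h, map_neg]

theorem verticalAction_involute (u : (gV.restrict _ hker).Cl) :
    verticalAction hD SB SM hker (CliffordAlgebra.involute u) =
      verticalGrading hD SB SM * verticalAction hD SB SM hker u * verticalGrading hD SB SM := by
  have hγ := verticalGrading_sq hD SB SM
  induction u using CliffordAlgebra.induction with
  | algebraMap r =>
    rw [AlgHom.commutes, AlgHom.commutes, ← Algebra.commutes, mul_assoc, hγ, mul_one]
  | ι X =>
    rw [CliffordAlgebra.involute_ι, map_neg, verticalAction_ι, verticalCliffordEnd_neg]
  | mul a b ha hb =>
    rw [map_mul, map_mul, map_mul, ha, hb]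
    simp only [mul_assoc]
    rw [← mul_assoc (verticalGrading hD SB SM) (verticalGrading hD SB SM), hγ, one_mul]
  | add a b ha hb => rw [map_add, map_add, map_add, mul_add, add_mul, ha, hb]

variable [Invertible (2 : A)] [Invertible (2 : R)]

/-- On E_H ⊗ E_V the operator 1 ⊗ c_V(X) equals c(wX): the grading built into c_V(X) is compensated
by w, which acts as γ_H on the factor E_H. -/
theorem contract_verticalAction (u : (gV.restrict _ hker).Cl) (p : R ⊗[A] EB)
    (v : VerticalSpinor hD SB SM) :
    contract hD SB SM p (verticalAction hD SB SM hker u v) =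
      SM.c (twistedInclusion hD SB hker u) (contract hD SB SM p v) := by
  induction u using CliffordAlgebra.induction generalizing v with
  | algebraMap r =>
    rw [AlgHom.commutes, AlgHom.commutes, AlgEquiv.commutes, Module.algebraMap_end_apply,
      Module.algebraMap_end_apply, map_smul]
  | ι X =>
    rw [verticalAction_ι, twistedInclusion_ι, ← vertical_mul_chirality, map_mul,
      Module.End.mul_apply, ← horizontalRep_action hD SB, horizontalAction_chirality,
      horizontalRep_contract]
    exact contract_twistedMap hD SB SM (vertical_clifford_comm SM X) p v
  | mul a b ha hb => rw [map_mul, map_mul, map_mul, Module.End.mul_apply, Module.End.mul_apply, ha, hb]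
  | add a b ha hb => simp only [map_add, LinearMap.add_apply, ha, hb]

/-- If c_V(u) = 0, then c(j(u)) kills all contractions, which span E_M; c and j are injective. -/
theorem verticalAction_injective : Function.Injective (verticalAction hD SB SM hker) := by
  rw [injective_iff_map_eq_zero]
  intro u hu
  refine (injective_iff_map_eq_zero _).1 (twistedInclusion_injective hD SB hker) u ?_
  refine (map_eq_zero_iff SM.c SM.c.injective).1 ?_
  refine linearMap_ext_contract hD SB SM fun p v => ?_
  rw [← contract_verticalAction, hu, LinearMap.zero_apply, map_zero, LinearMap.zero_apply]

/-- An operator S extends to 1 ⊗ S on E_M, which is c(∑ a j(u)). Contracting back over E_H replaces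
each a by scalars φ_j(c_H(a)p_j) and leaves a combination of the c_V(u). -/
theorem verticalAction_surjective : Function.Surjective (verticalAction hD SB SM hker) := by
  intro S
  obtain ⟨n, e, e', he, -⟩ := exists_eq_sum_contract hD SB SM
  obtain ⟨m, p, φ, hφ⟩ := exists_sum_dual_eq_one hD SB
  -- This is 1 ⊗ S, written with a dual basis of E_H.
  let S' : Module.End R EM :=
    ∑ i, (contract hD SB SM (e i)).comp (S.comp (verticalMk hD SB SM (e' i)))
  have hS' : ∀ q v, S' (contract hD SB SM q v) = contract hD SB SM q (S v) := by
    intro q v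
    simp only [S', LinearMap.sum_apply, LinearMap.comp_apply, verticalMk_contract, map_smul]
    conv_rhs => rw [← he q, map_sum, LinearMap.sum_apply]
    simp only [map_smul, LinearMap.smul_apply]
  obtain ⟨b, hb⟩ := SM.c.surjective S'
  obtain ⟨t, rfl⟩ := cliffordFactorization_surjective hD SB hker b
  have hS : S = ∑ j, (verticalMk hD SB SM (φ j)).comp
      ((SM.c (cliffordFactorization hD SB hker t)).comp (contract hD SB SM (p j))) := by
    refine LinearMap.ext fun v => ?_
    simp only [LinearMap.sum_apply, LinearMap.comp_apply, hb, hS', verticalMk_contract]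
    rw [← Finset.sum_smul, hφ, one_smul]
  rw [hS]
  clear hS hb hS'
  change _ ∈ (verticalAction hD SB SM hker).toLinearMap.range
  refine Submodule.sum_mem _ fun j _ => ?_
  induction t using TensorProduct.induction_on with
  | zero =>
    rw [map_zero, map_zero, LinearMap.zero_comp, LinearMap.comp_zero]
    exact zero_mem _
  | add t t' ht ht' =>
    rw [map_add, map_add, LinearMap.add_comp, LinearMap.comp_add]
    exact add_mem ht ht'
  | tmul a u =>
    refine ⟨φ j (horizontalAction hD SB a (p j)) • u, LinearMap.ext fun v => ?_⟩
    rw [AlgHom.toLinearMap_apply, map_smul, LinearMap.smul_apply, ← verticalMk_contract,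
      ← horizontalRep_contract, contract_verticalAction, horizontalRep_action,
      cliffordFactorization_tmul, map_mul]
    rfl

/-- The vertical Clifford action as an isomorphism. -/
def verticalActionEquiv :
    (gV.restrict _ hker).Cl ≃ₐ[R] Module.End R (VerticalSpinor hD SB SM) :=
  AlgEquiv.ofBijective (verticalAction hD SB SM hker)
    ⟨verticalAction_injective hD SB SM hker, verticalAction_surjective hD SB SM hker⟩

end VerticalAction
end Submersion

section Submersion

variable {A R W V : Type*} [CommRing A] [StarRing A] [PartialOrder A]
  [CommRing R] [StarRing R] [PartialOrder R] [Algebra A R]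
  [AddCommGroup W] [Module A W] [AddCommGroup V] [Module R V]
  {gV : ComplexMetric R V} {gW : ComplexMetric A W} {D : V →ₗ[R] R ⊗[A] W}
  {EB : Type*} [AddCommGroup EB] [Module A EB]
  {EM : Type*} [AddCommGroup EM] [Module R EM]

/-! ### Identification of the subalgebra `Cl_V` with Cl(ker D). -/

section VerticalSubalgebra

variable (hker : ∀ X ∈ LinearMap.ker D, gV.conj X ∈ LinearMap.ker D)

theorem range_verticalInclusion : (verticalInclusion hker).range = verticalClifford gV D := by
  rw [← Algebra.map_top, ← CliffordAlgebra.adjoin_range_ι, AlgHom.map_adjoin]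
  unfold verticalClifford ComplexMetric.subalgebra
  congr 1
  ext b
  constructor
  · rintro ⟨_, ⟨X, rfl⟩, rfl⟩
    exact ⟨X, X.2, (verticalInclusion_ι hker X).symm⟩
  · rintro ⟨X, hX, rfl⟩
    exact ⟨_, ⟨⟨X, hX⟩, rfl⟩, verticalInclusion_ι hker ⟨X, hX⟩⟩

variable [Invertible (2 : A)] [Invertible (2 : R)]

/-- The subalgebra `Cl_V ⊆ Cl` is the Clifford algebra of the vertical vectors. -/
def verticalCliffordEquiv (hD : IsRiemannianDifferential gV gW D) (SB : SpinorModule gW EB) :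
    (gV.restrict _ hker).Cl ≃ₐ[R] verticalClifford gV D :=
  (AlgEquiv.ofInjective _ (verticalInclusion_injective hker hD SB)).trans
    (Subalgebra.equivOfEq _ _ (range_verticalInclusion hker))

end VerticalSubalgebra

/-! ### Adjoints and the hermitian form of E_V. -/

section Conjugation

variable (R) in
/-- The conjugation `f ⊗ Y ↦ f̄ ⊗ Ȳ` of `R ⊗ W`. -/
def conjBaseChange [StarModule A R] (gW : ComplexMetric A W) : R ⊗[A] W →+ R ⊗[A] W :=
  TensorProduct.liftAddHom
    { toFun := fun f =>
        { toFun := fun Y => star f ⊗ₜ gW.conj Y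
          map_zero' := by simp
          map_add' := fun Y Z => by rw [map_add, TensorProduct.tmul_add] }
      map_zero' := by ext; simp
      map_add' := fun f g => by
        ext Y
        simp [TensorProduct.add_tmul] }
    (fun a f Y => by
      simp only [AddMonoidHom.coe_mk, ZeroHom.coe_mk, LinearMap.map_smulₛₗ, star_smul,
        starRingEnd_apply]
      exact TensorProduct.smul_tmul _ _ _)

theorem conjBaseChange_tmul [StarModule A R] (gW : ComplexMetric A W) (f : R) (Y : W) :
    conjBaseChange R gW (f ⊗ₜ Y) = star f ⊗ₜ gW.conj Y := rfl

variable [StarModule A R]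

/-- This extends c(Y)^* = c(Ȳ) from the base: scalars f are conjugated by the form, vectors by the
spinor module axiom. -/
theorem pulledClifford_adjoint (SB : SpinorModule gW EB) (t : R ⊗[A] W) (ξ η : R ⊗[A] EB) :
    pulledHermitian R SB (pulledClifford R SB t ξ) η =
      pulledHermitian R SB ξ (pulledClifford R SB (conjBaseChange R gW t) η) := by
  induction t using TensorProduct.induction_on with
  | zero => simp
  | add t u ht hu => simp only [map_add, LinearMap.add_apply, ht, hu]
  | tmul f Y =>
    induction ξ using TensorProduct.induction_on with
    | zero => simp
    | add ξ ξ' h h' => simp only [map_add, LinearMap.add_apply, h, h']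
    | tmul g s =>
      induction η using TensorProduct.induction_on with
      | zero => simp
      | add ξ ξ' h h' => simp only [map_add, h, h']
      | tmul k t =>
        have h := SB.c_cstar (gW.ι (gW.conj Y)) s t
        rw [ComplexMetric.cstar_ι, gW.conj_conj] at h
        rw [conjBaseChange_tmul, pulledClifford_tmul, pulledClifford_tmul, pulledHermitian_tmul,
          pulledHermitian_tmul, h, star_mul']
        ring

variable (hD : IsRiemannianDifferential gV gW D) (SB : SpinorModule gW EB)
  (SM : SpinorModule gV EM)

theorem conj_mem_ker
    (hconj : ∀ X, D (gV.conj X) = conjBaseChange R gW (D X)) (X : V) (hX : X ∈ LinearMap.ker D) :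
    gV.conj X ∈ LinearMap.ker D := by
  rw [LinearMap.mem_ker] at hX ⊢
  rw [hconj, hX, map_zero]

/-- The kernel is stable under conjugation, hence so is its orthogonal complement for a form
compatible with conjugation. -/
theorem conj_mem_horizontal
    (hconj : ∀ X, D (gV.conj X) = conjBaseChange R gW (D X)) (X : V) (hX : X ∈ horizontal gV D) :
    gV.conj X ∈ horizontal gV D := by
  intro Y hY
  have h : gV.bilin (gV.conj Y) X = 0 := hX _ (conj_mem_ker hconj Y hY)
  change gV.bilin Y (gV.conj X) = 0
  rw [← gV.conj_conj Y, gV.bilin_conj, h, star_zero]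

/-- Every element of the horizontal Clifford algebra has an adjoint that is compatible with its
actions on `E_H` and on `E_M`. -/
theorem exists_horizontal_adjoint
    (hconj : ∀ X, D (gV.conj X) = conjBaseChange R gW (D X)) (a : HorizontalClifford gV D) :
    ∃ b : HorizontalClifford gV D,
      (∀ ξ η, pulledHermitian R SB (horizontalAction hD SB a ξ) η =
        pulledHermitian R SB ξ (horizontalAction hD SB b η)) ∧
      ∀ s t, SM.herm.form (SM.c (horizontalInclusion gV D a) s) t =
        SM.herm.form s (SM.c (horizontalInclusion gV D b) t) := by
  -- The adjoint is built by conjugating scalars and horizontal vectors and reversing products; the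
  -- same element must serve on E_H and on E_M.
  induction a using CliffordAlgebra.induction with
  | algebraMap r =>
    refine ⟨algebraMap R _ (star r), fun ξ η => ?_, fun s t => ?_⟩
    · simp [AlgHom.commutes, Module.algebraMap_end_apply, starRingEnd_apply]
    · simp [AlgHom.commutes, AlgEquiv.commutes, Module.algebraMap_end_apply, starRingEnd_apply]
  | ι X =>
    have hι : ∀ Y : horizontal gV D, horizontalInclusion gV D (CliffordAlgebra.ι _ Y) = gV.ι Y :=
      fun Y => CliffordAlgebra.map_apply_ι _ _
    refine ⟨CliffordAlgebra.ι _ ⟨_, conj_mem_horizontal hconj X X.2⟩, fun ξ η => ?_, fun s t => ?_⟩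
    · rw [horizontalAction_ι, horizontalAction_ι, pulledClifford_adjoint, hconj]
    · have h := SM.c_cstar (gV.ι (gV.conj X)) s t
      rw [ComplexMetric.cstar_ι, gV.conj_conj] at h
      rw [hι, hι, h]
  | mul a a' ha ha' =>
    obtain ⟨b, hb⟩ := ha
    obtain ⟨b', hb'⟩ := ha'
    refine ⟨b' * b, fun ξ η => ?_, fun s t => ?_⟩
    · simp only [map_mul, Module.End.mul_apply, hb.1, hb'.1]
    · simp only [map_mul, Module.End.mul_apply, hb.2, hb'.2]
  | add a a' ha ha' =>
    obtain ⟨b, hb⟩ := ha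
    obtain ⟨b', hb'⟩ := ha'
    refine ⟨b + b', fun ξ η => ?_, fun s t => ?_⟩
    · simp only [map_add, LinearMap.add_apply, hb.1, hb'.1]
    · simp only [map_add, LinearMap.add_apply, hb.2, hb'.2]

variable [Invertible (2 : A)] [Invertible (2 : R)]

/-- On E_H the adjoint of |ξ⟩⟨η| is |η⟩⟨ξ|. The common adjoint in `Cl_H` carries this relation over
to E_M. -/
theorem horizontalRep_ketbra_adjoint
    (hconj : ∀ X, D (gV.conj X) = conjBaseChange R gW (D X)) (ξ η : R ⊗[A] EB) (s t : EM) :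
    SM.herm.form (horizontalRep hD SB SM (ketbra SB ξ η) s) t =
      SM.herm.form s (horizontalRep hD SB SM (ketbra SB η ξ) t) := by
  obtain ⟨a, ha⟩ := (horizontalAction_bijective hD SB).2 (ketbra SB ξ η)
  obtain ⟨b, hb, hb'⟩ := exists_horizontal_adjoint hD SB SM hconj a
  have h : horizontalAction hD SB b = ketbra SB η ξ := by
    -- The adjoint on E_H is unique because the form on E_H separates points.
    refine LinearMap.ext fun ζ => sub_eq_zero.1 (pulledHermitian_separating SB fun χ => ?_)
    rw [map_sub, ← hb, ha, sub_eq_zero]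
    simp only [ketbra, LinearMap.smulRight_apply, LinearMap.map_smulₛₗ, LinearMap.smul_apply,
      smul_eq_mul, starRingEnd_apply, star_pulledHermitian, map_smul]
    exact mul_comm _ _
  rw [← ha, ← h, horizontalRep_action, horizontalRep_action, hb']

theorem contract_mk_bra (p ξ : R ⊗[A] EB) (s : EM) :
    contract hD SB SM p (verticalMk hD SB SM (pulledHermitian R SB ξ) s) =
      horizontalRep hD SB SM (ketbra SB p ξ) s :=
  contract_mk _ _ _ _ _ _

/-- Moving |q⟩⟨ξ| to the other side gives |ξ⟩⟨q| applied to p·v, which is ⟨q,p⟩ ξ·v. -/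
theorem form_contract_mk
    (hconj : ∀ X, D (gV.conj X) = conjBaseChange R gW (D X)) (q p ξ : R ⊗[A] EB)
    (s : EM) (v : VerticalSpinor hD SB SM) :
    SM.herm.form (contract hD SB SM q (verticalMk hD SB SM (pulledHermitian R SB ξ) s))
      (contract hD SB SM p v) =
      pulledHermitian R SB q p * SM.herm.form s (contract hD SB SM ξ v) := by
  rw [contract_mk_bra, horizontalRep_ketbra_adjoint hD SB SM hconj, horizontalRep_contract]
  simp [ketbra]

theorem exists_sum_pulledHermitian_eq_one (hD : IsRiemannianDifferential gV gW D)
    (SB : SpinorModule gW EB) :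
    ∃ (n : ℕ) (q p : Fin n → R ⊗[A] EB), ∑ j, pulledHermitian R SB (q j) (p j) = 1 := by
  obtain ⟨n, p, φ, hφ⟩ := exists_sum_dual_eq_one hD SB
  choose q hq using fun j => pulledHermitian_surjective SB (φ j)
  exact ⟨n, q, p, by simpa only [hq] using hφ⟩

/-- The values ⟨q,p⟩ generate the unit ideal, so they can be cancelled jointly. -/
theorem eq_of_pulledHermitian_mul_eq {x y : R}
    (hD : IsRiemannianDifferential gV gW D)
    (h : ∀ q p, pulledHermitian R SB q p * x = pulledHermitian R SB q p * y) : x = y := by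
  obtain ⟨n, q, p, hqp⟩ := exists_sum_pulledHermitian_eq_one hD SB
  rw [← one_mul x, ← one_mul y, ← hqp, Finset.sum_mul, Finset.sum_mul]
  exact Finset.sum_congr rfl fun j _ => h _ _

/-- The hermitian form of `E_V` is characterised by the isometry `E_H ⊗ E_V → E_M`. -/
theorem exists_vertical_form
    (hconj : ∀ X, D (gV.conj X) = conjBaseChange R gW (D X)) :
    ∃ h : VerticalSpinor hD SB SM →ₗ⋆[R] VerticalSpinor hD SB SM →ₗ[R] R,
      (∀ ξ s v, h (verticalMk hD SB SM (pulledHermitian R SB ξ) s) v =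
        SM.herm.form s (contract hD SB SM ξ v)) ∧
      ∀ q p u v, SM.herm.form (contract hD SB SM q u) (contract hD SB SM p v) =
        pulledHermitian R SB q p * h u v := by
  obtain ⟨n, q, p, hqp⟩ := exists_sum_pulledHermitian_eq_one hD SB
  -- Summing the desired relation ⟨q·u, p·v⟩ = ⟨q,p⟩ h(u,v) over pairs with ∑ ⟨q_j,p_j⟩ = 1 forces
  -- this formula. It is well defined because contractions already live on the quotient.
  let h : VerticalSpinor hD SB SM →ₗ⋆[R] VerticalSpinor hD SB SM →ₗ[R] R :=
    LinearMap.mk₂'ₛₗ (starRingEnd R) (RingHom.id R)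
      (fun u v => ∑ j, SM.herm.form (contract hD SB SM (q j) u) (contract hD SB SM (p j) v))
      (fun u u' v => by simp [Finset.sum_add_distrib])
      (fun r u v => by simp [Finset.mul_sum])
      (fun u v v' => by simp [Finset.sum_add_distrib])
      (fun r u v => by simp [Finset.mul_sum])
  have h1 : ∀ ξ s v, h (verticalMk hD SB SM (pulledHermitian R SB ξ) s) v =
      SM.herm.form s (contract hD SB SM ξ v) := fun ξ s v => by
    change ∑ j, SM.herm.form (contract hD SB SM (q j) _) (contract hD SB SM (p j) v) = _
    simp only [form_contract_mk hD SB SM hconj]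
    rw [← Finset.sum_mul, hqp, one_mul]
  refine ⟨h, h1, fun q p u v => ?_⟩
  induction u using BalancedTensor.induction_on with
  | add u w hu hw => simp only [map_add, LinearMap.add_apply, hu, hw, mul_add]
  | mkBilin φ s =>
    obtain ⟨ξ, rfl⟩ := pulledHermitian_surjective SB φ
    rw [form_contract_mk hD SB SM hconj, h1]

/-- If `S'` is the adjoint of `S` on `E_M`, then `γ_H^* ⊗ S'` is the adjoint of `γ_H^* ⊗ S`. -/
theorem form_twistedMap {h : VerticalSpinor hD SB SM →ₗ⋆[R] VerticalSpinor hD SB SM →ₗ[R] R}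
    (hh : ∀ q p u v, SM.herm.form (contract hD SB SM q u) (contract hD SB SM p v) =
      pulledHermitian R SB q p * h u v)
    {S S' : Module.End R EM}
    (hS : ∀ a, S * SM.c (horizontalInclusion gV D a) =
      SM.c (horizontalInclusion gV D (CliffordAlgebra.involute a)) * S)
    (hS' : ∀ a, S' * SM.c (horizontalInclusion gV D a) =
      SM.c (horizontalInclusion gV D (CliffordAlgebra.involute a)) * S')
    (hadj : ∀ s t, SM.herm.form (S s) t = SM.herm.form s (S' t))
    (u v : VerticalSpinor hD SB SM) :
    h (BalancedTensor.twistedMap CliffordAlgebra.involute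
        (horizontalGrading R SB).dualMap S (dualGrading_comm hD SB) hS u) v =
      h u (BalancedTensor.twistedMap CliffordAlgebra.involute
        (horizontalGrading R SB).dualMap S' (dualGrading_comm hD SB) hS' v) := by
  have hγ : ∀ p, horizontalGrading R SB (horizontalGrading R SB p) = p := fun p =>
    LinearMap.congr_fun (horizontalGrading_sq SB) p
  refine eq_of_pulledHermitian_mul_eq SB hD fun q p => ?_
  -- Each side produces one γ_H on E_H; they cancel in ⟨γ_H q, γ_H p⟩ = ⟨q,p⟩.
  have e := contract_twistedMap hD SB SM hS' (horizontalGrading R SB p) v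
  rw [hγ] at e
  rw [← hh, contract_twistedMap hD SB SM hS, hadj, ← e, hh, pulledHermitian_grading, hγ]

/-- The vertical spinor module is a spinor module for the Clifford algebra of the vertical
vectors. -/
theorem exists_vertical_spinorModule
    (hconj : ∀ X, D (gV.conj X) = conjBaseChange R gW (D X))
    (hker : ∀ X ∈ LinearMap.ker D, gV.conj X ∈ LinearMap.ker D)
    (hpos : ∀ r : R, (∀ s, 0 ≤ algebraMap A R (SB.herm.form s s) * r) → 0 ≤ r) :
    ∃ h : HermitianForm R (VerticalSpinor hD SB SM),
      IsVerticalHermitian hD SB SM h.form ∧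
      (∃ cV : verticalClifford gV D ≃ₐ[R] Module.End R (VerticalSpinor hD SB SM),
          (∀ X : LinearMap.ker D, cV (verticalι gV D X) = verticalCliffordEnd hD SB SM X) ∧
          (∀ a, cV (verticalInvolute a) =
            verticalGrading hD SB SM * cV a * verticalGrading hD SB SM) ∧
          (∀ a s t, h.form (cV (verticalCstar hker a) s) t = h.form s (cV a t))) ∧
      (∃ K : SpinorModule (gV.restrict _ hker) (VerticalSpinor hD SB SM),
          K.herm = h ∧ K.γ = verticalGrading hD SB SM ∧
          ∀ X : LinearMap.ker D,
            K.c ((gV.restrict _ hker).ι X) = verticalCliffordEnd hD SB SM X) := by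
  obtain ⟨f, hf, hh⟩ := exists_vertical_form hD SB SM hconj
  let h : HermitianForm R (VerticalSpinor hD SB SM) :=
    { form := f
      star_form := fun u v => eq_of_pulledHermitian_mul_eq SB hD (fun q p => by
        rw [← hh, ← SM.herm.star_form, hh, star_mul', star_pulledHermitian])
      -- For q = p = 1 ⊗ s the characterising relation reads ⟨s,s⟩ h(u,u) = ⟨p·u, p·u⟩ ≥ 0.
      nonneg := fun u => hpos _ fun s => by
        have e := hh (1 ⊗ₜ s) (1 ⊗ₜ s) u u
        rw [pulledHermitian_tmul, star_one, one_mul, mul_one] at e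
        rw [← e]
        exact SM.herm.nonneg _
      perfect := by
        constructor
        · intro u u' huu'
          -- Each q·(u - u') is orthogonal to all contractions, hence zero by non-degeneracy on E_M.
          refine sub_eq_zero.1 (eq_zero_of_contract_eq_zero hD SB SM fun q => ?_)
          refine SM.herm.perfect.1 (linearMap_ext_contract hD SB SM fun p v => ?_)
          have e : f u v = f u' v := LinearMap.congr_fun huu' v
          simp only [hh, map_sub, LinearMap.sub_apply, map_zero, LinearMap.zero_apply, e, sub_self]
        · intro ℓ
          obtain ⟨n, p, φ, hφ⟩ := exists_sum_dual_eq_one hD SB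
          -- Let t_j represent s ↦ ℓ(φ_j ⊗ s) on E_M. Then ∑ ⟨p_j| ⊗ t_j represents ℓ, because ∑
          -- ℓ(φ_j ⊗ p_j·v) = ∑ φ_j(p_j) ℓ(v) = ℓ(v).
          choose t ht using fun j => SM.herm.perfect.2 (ℓ.comp (verticalMk hD SB SM (φ j)))
          refine ⟨∑ j, verticalMk hD SB SM (pulledHermitian R SB (p j)) (t j),
            LinearMap.ext fun v => ?_⟩
          have ht' : ∀ j s, SM.herm.form (t j) s = ℓ (verticalMk hD SB SM (φ j) s) :=
            fun j s => LinearMap.congr_fun (ht j) s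
          simp only [map_sum, LinearMap.sum_apply, hf, ht', verticalMk_contract]
          rw [← map_sum, ← Finset.sum_smul, hφ, one_smul] }
  have hstar : ∀ (u : (gV.restrict _ hker).Cl) (s t : VerticalSpinor hD SB SM),
      f (verticalAction hD SB SM hker ((gV.restrict _ hker).cstar u) s) t =
        f s (verticalAction hD SB SM hker u t) := by
    intro u
    induction u using CliffordAlgebra.induction with
    | algebraMap r =>
      intro s t
      rw [ComplexMetric.cstar_algebraMap, AlgHom.commutes, AlgHom.commutes,
        Module.algebraMap_end_apply, Module.algebraMap_end_apply, LinearMap.map_smulₛₗ,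
        LinearMap.smul_apply, map_smul, starRingEnd_apply, star_star]
    | ι X =>
      intro s t
      rw [ComplexMetric.cstar_ι, verticalAction_ι, verticalAction_ι]
      -- The adjoint of γ_H^* ⊗ c(X) is γ_H^* ⊗ c(X)^*, and c(X)^* = c(X̄) on E_M.
      refine form_twistedMap hD SB SM hh _ _ (fun s t => ?_) s t
      have e := SM.c_cstar (gV.ι X) s t
      rw [ComplexMetric.cstar_ι] at e
      exact e
    | mul a b ha hb =>
      intro s t
      rw [ComplexMetric.cstar_mul, map_mul, map_mul, Module.End.mul_apply, Module.End.mul_apply,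
        hb, ha]
    | add a b ha hb =>
      intro s t
      rw [ComplexMetric.cstar_add, map_add, map_add, LinearMap.add_apply, LinearMap.add_apply,
        map_add, map_add, LinearMap.add_apply, ha, hb]
  refine ⟨h, fun ξ₁ ξ₂ s₁ s₂ => ?_, ?_, ?_⟩
  · obtain ⟨a, ha⟩ := (horizontalAction_bijective hD SB).2 (ketbra SB ξ₁ ξ₂)
    refine ⟨a, ha, (hf ξ₁ s₁ _).trans ?_⟩
    rw [← horizontalRep_action hD SB, ha]
    exact congrArg _ (contract_mk_bra hD SB SM ξ₁ ξ₂ s₂)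
  · let e := verticalCliffordEquiv hker hD SB
    have he : ∀ a, verticalInclusion hker (e.symm a) = a := fun a =>
      congrArg Subtype.val (e.apply_symm_apply a)
    refine ⟨e.symm.trans (verticalActionEquiv hD SB SM hker), fun X => ?_, fun a => ?_,
      fun a s t => ?_⟩
    · have h1 : e.symm (verticalι gV D X) = (gV.restrict _ hker).ι X :=
        e.symm_apply_eq.2 (Subtype.ext (verticalInclusion_ι hker X).symm)
      change verticalAction hD SB SM hker (e.symm (verticalι gV D X)) = _
      rw [h1, verticalAction_ι]
    · have h1 : e.symm (verticalInvolute a) = CliffordAlgebra.involute (e.symm a) := by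
        refine e.symm_apply_eq.2 (Subtype.ext ?_)
        change CliffordAlgebra.involute (a : gV.Cl) = verticalInclusion hker _
        rw [verticalInclusion_involute, he]
      change verticalAction hD SB SM hker (e.symm (verticalInvolute a)) = _
      rw [h1, verticalAction_involute]
      rfl
    · have h1 : e.symm (verticalCstar hker a) = (gV.restrict _ hker).cstar (e.symm a) := by
        refine e.symm_apply_eq.2 (Subtype.ext ?_)
        change gV.cstar (a : gV.Cl) = verticalInclusion hker _
        rw [verticalInclusion_cstar, he]
      change f (verticalAction hD SB SM hker (e.symm (verticalCstar hker a)) s) t = _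
      rw [h1, hstar]
      rfl
  · exact ⟨{ finite := (verticalSpinor_finite_projective hD SB SM).1
             projective := (verticalSpinor_finite_projective hD SB SM).2
             γ := verticalGrading hD SB SM
             γ_sq := verticalGrading_sq hD SB SM
             herm := h
             γ_selfAdjoint := form_twistedMap hD SB SM hh _ _ SM.γ_selfAdjoint
             c := verticalActionEquiv hD SB SM hker
             c_involute := verticalAction_involute hD SB SM hker
             c_cstar := hstar }, rfl, rfl, verticalAction_ι hD SB SM hker⟩

end Conjugation
end Submersion

/-! ### Smooth functions: reality of the differential and positivity. -/

section Geometry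

open Bundle

namespace SmoothC

variable {E : Type*} [NormedAddCommGroup E] [NormedSpace ℝ E]
  {H : Type*} [TopologicalSpace H] {I : ModelWithCorners ℝ E H}
  {M : Type*} [TopologicalSpace M] [ChartedSpace H M]

/-- The constant function. -/
def const (z : ℂ) : SmoothC I M := ⟨fun _ => z, contMDiff_const⟩

theorem const_apply (z : ℂ) (x : M) : (const z : SmoothC I M) x = z := rfl

theorem two_apply (x : M) : (2 : SmoothC I M) x = 2 := by
  rw [← one_add_one_eq_two, add_apply]
  exact one_add_one_eq_two

theorem const_half_mul_two : (const 2⁻¹ : SmoothC I M) * 2 = 1 := ContMDiffMap.ext fun x => by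
  rw [mul_apply, const_apply, two_apply]
  exact inv_mul_cancel₀ two_ne_zero

instance : Invertible (2 : SmoothC I M) where
  invOf := const 2⁻¹
  invOf_mul_self := const_half_mul_two
  mul_invOf_self := (mul_comm _ _).trans const_half_mul_two

end SmoothC

variable {EM : Type*} [NormedAddCommGroup EM] [NormedSpace ℝ EM]
  {HM : Type*} [TopologicalSpace HM] {IM : ModelWithCorners ℝ EM HM}
  {M : Type*} [TopologicalSpace M] [ChartedSpace HM M] [IsManifold IM ∞ M]
  {EB : Type*} [NormedAddCommGroup EB] [NormedSpace ℝ EB]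
  {HB : Type*} [TopologicalSpace HB] {IB : ModelWithCorners ℝ EB HB}
  {B : Type*} [TopologicalSpace B] [ChartedSpace HB B] [IsManifold IB ∞ B]

theorem evalAlong_conj [RiemannianBundle (fun x : B => TangentSpace IB x)]
    [IsContMDiffRiemannianBundle IB ∞ EB (fun x : B => TangentSpace IB x)]
    (pr : C^∞⟮IM, M; IB, B⟯) (x : M) :
    letI := pullbackAlgebra pr
    haveI := pullback_starModule pr
    ∀ t : SmoothC IM M ⊗[SmoothC IB B] ComplexVectorField IB B,
      evalAlong pr x (conjBaseChange (SmoothC IM M) (vectorFieldMetric IB B) t) =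
        ((evalAlong pr x t).1, -(evalAlong pr x t).2) := by
  let _ := pullbackAlgebra pr
  have := pullback_starModule pr
  intro t
  induction t using TensorProduct.induction_on with
  | zero =>
    simp only [map_zero, Prod.fst_zero, Prod.snd_zero, neg_zero]
    rfl
  | add t u ht hu =>
    simp only [map_add, ht, hu, Prod.fst_add, Prod.snd_add, Prod.mk_add_mk]
    rw [neg_add]
  | tmul f Y =>
    rw [conjBaseChange_tmul, evalAlong_tmul, evalAlong_tmul]
    change ((f x).re • Y.re (pr x) - (-(f x).im) • -Y.im (pr x),
      (f x).re • -Y.im (pr x) + (-(f x).im) • Y.re (pr x)) = _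
    refine Prod.ext ?_ ?_
    · change (f x).re • Y.re (pr x) - (-(f x).im) • -Y.im (pr x) =
        (f x).re • Y.re (pr x) - (f x).im • Y.im (pr x)
      module
    · change (f x).re • -Y.im (pr x) + (-(f x).im) • Y.re (pr x) =
        -((f x).re • Y.im (pr x) + (f x).im • Y.re (pr x))
      module

/-- Elements of C^∞(M) ⊗ 𝒳(B) are detected by their values at the points of M, and dπ_x is a real
map. -/
theorem differential_conj [FiniteDimensional ℝ EB] [T2Space B] [CompactSpace B]
    [RiemannianBundle (fun x : B => TangentSpace IB x)]
    [IsContMDiffRiemannianBundle IB ∞ EB (fun x : B => TangentSpace IB x)]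
    (pr : C^∞⟮IM, M; IB, B⟯) (X : ComplexVectorField IM M) :
    letI := pullbackAlgebra pr
    haveI := pullback_starModule pr
    differential pr (ComplexVectorField.conj X) =
      conjBaseChange (SmoothC IM M) (vectorFieldMetric IB B) (differential pr X) := by
  let _ := pullbackAlgebra pr
  have := pullback_starModule pr
  refine sub_eq_zero.1 (evalAlong_injective pr _ fun x => ?_)
  rw [map_sub, evalAlong_conj, differential_spec, differential_spec,
    ComplexVectorField.conj_re_apply, ComplexVectorField.conj_im_apply, map_neg, sub_self]

/-- If a hermitian form over `C^∞(B)` vanishes on the diagonal at a point, it vanishes there. -/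
theorem form_apply_eq_zero_of_diagonal {F : Type*} [AddCommGroup F] [Module (SmoothC IB B) F]
    (h : HermitianForm (SmoothC IB B) F) (b : B) (h0 : ∀ s, h.form s s b = 0) (s t : F) :
    h.form s t b = 0 := by
  have hre : ∀ s t : F, (h.form s t b).re = 0 := by
    intro s t
    have e := h0 (s + t)
    simp only [map_add, LinearMap.add_apply, SmoothC.add_apply, h0, zero_add, add_zero] at e
    rw [← h.star_form s t, SmoothC.star_apply] at e
    have e' := congrArg Complex.re e
    simp only [Complex.add_re, Complex.zero_re] at e'
    change (h.form s t b).re + (h.form s t b).re = 0 at e'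
    linarith
  refine Complex.ext (hre s t) ?_
  -- Replacing t by i t turns the vanishing of real parts into that of imaginary parts.
  have e := hre s ((SmoothC.const Complex.I : SmoothC IB B) • t)
  rw [map_smul, SmoothC.smul_apply, SmoothC.const_apply, Complex.I_mul_re] at e
  exact neg_eq_zero.1 e

open scoped ComplexOrder in
-- At each point x some ⟨s,s⟩(π(x)) is strictly positive and can be divided out. Otherwise
-- polarization makes the whole form on E_H vanish at x, contradicting ∑ ⟨q_j,p_j⟩ = 1.
theorem nonneg_of_form_mul_nonneg
    [RiemannianBundle (fun x : M => TangentSpace IM x)]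
    [IsContMDiffRiemannianBundle IM ∞ EM (fun x : M => TangentSpace IM x)]
    [FiniteDimensional ℝ EB] [T2Space B] [CompactSpace B]
    [RiemannianBundle (fun x : B => TangentSpace IB x)]
    [IsContMDiffRiemannianBundle IB ∞ EB (fun x : B => TangentSpace IB x)]
    (pr : C^∞⟮IM, M; IB, B⟯) (hpr : IsRiemannianSubmersion pr)
    {F : Type*} [AddCommGroup F] [Module (SmoothC IB B) F]
    (SB : SpinorModule (vectorFieldMetric IB B) F) (r : SmoothC IM M) :
    letI := pullbackAlgebra pr
    (∀ s, 0 ≤ algebraMap (SmoothC IB B) (SmoothC IM M) (SB.herm.form s s) * r) → 0 ≤ r := by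
  let _ := pullbackAlgebra pr
  have := pullback_starModule pr
  intro hr x
  by_cases h0 : ∀ s, SB.herm.form s s (pr x) = 0
  · exfalso
    have h1 := form_apply_eq_zero_of_diagonal SB.herm (pr x) h0
    have h2 : ∀ ξ η : SmoothC IM M ⊗[SmoothC IB B] F,
        pulledHermitian (SmoothC IM M) SB ξ η x = 0 := by
      intro ξ η
      induction ξ using TensorProduct.induction_on with
      | zero => rw [map_zero]; rfl
      | add ξ ξ' h h' => rw [map_add, LinearMap.add_apply, SmoothC.add_apply, h, h', add_zero]
      | tmul f s =>
        induction η using TensorProduct.induction_on with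
        | zero => rw [map_zero]; rfl
        | add ξ ξ' h h' => rw [map_add, SmoothC.add_apply, h, h', add_zero]
        | tmul g t =>
          rw [pulledHermitian_tmul, SmoothC.mul_apply, SmoothC.mul_apply]
          change _ * SB.herm.form s t (pr x) * _ = _
          rw [h1, mul_zero, zero_mul]
    obtain ⟨n, q, p, hqp⟩ := exists_sum_pulledHermitian_eq_one hpr SB
    have h3 := congrArg (fun f : SmoothC IM M => f x) hqp
    let ev : SmoothC IM M →+ ℂ :=
      { toFun := fun f => f x, map_zero' := rfl, map_add' := fun _ _ => rfl }
    have h4 : ev (∑ j, pulledHermitian (SmoothC IM M) SB (q j) (p j)) = 0 := by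
      rw [map_sum]
      exact Finset.sum_eq_zero fun j _ => h2 _ _
    exact one_ne_zero (h3.symm.trans h4)
  · push Not at h0
    obtain ⟨s, hs⟩ := h0
    have h1 : 0 ≤ SB.herm.form s s (pr x) := SB.herm.nonneg s (pr x)
    have h2 : 0 ≤ SB.herm.form s s (pr x) * r x := hr s x
    change 0 ≤ r x
    rw [Complex.le_def] at h1 h2 ⊢
    have him : (SB.herm.form s s (pr x)).im = 0 := h1.2.symm
    have hre : 0 < (SB.herm.form s s (pr x)).re :=
      lt_of_le_of_ne h1.1 fun h => hs (Complex.ext h.symm him)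
    rw [Complex.mul_re, Complex.mul_im, him, zero_mul, sub_zero, zero_mul, add_zero] at h2
    exact ⟨(mul_nonneg_iff_of_pos_left hre).1 h2.1,
      ((mul_eq_zero.1 h2.2.symm).resolve_left hre.ne').symm⟩

end Geometry

end VertClif

end

/-- This is the algebraic theorem over C^∞(B) → C^∞(M). Geometry enters through the compatibility of
dπ with conjugation, the conjugation-stability of its kernel, and pointwise positivity. -/
theorem propositionl
    {EM : Type*} [NormedAddCommGroup EM] [NormedSpace ℝ EM] [FiniteDimensional ℝ EM]
    {HM : Type*} [TopologicalSpace HM] {IM : ModelWithCorners ℝ EM HM}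
    {M : Type*} [TopologicalSpace M] [ChartedSpace HM M] [IsManifold IM ∞ M]
    [BoundarylessManifold IM M] [T2Space M] [CompactSpace M]
    [Bundle.RiemannianBundle (fun x : M => TangentSpace IM x)]
    [IsContMDiffRiemannianBundle IM ∞ EM (fun x : M => TangentSpace IM x)]
    {EB : Type*} [NormedAddCommGroup EB] [NormedSpace ℝ EB] [FiniteDimensional ℝ EB]
    {HB : Type*} [TopologicalSpace HB] {IB : ModelWithCorners ℝ EB HB}
    {B : Type*} [TopologicalSpace B] [ChartedSpace HB B] [IsManifold IB ∞ B]
    [BoundarylessManifold IB B] [T2Space B] [CompactSpace B]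
    [Bundle.RiemannianBundle (fun x : B => TangentSpace IB x)]
    [IsContMDiffRiemannianBundle IB ∞ EB (fun x : B => TangentSpace IB x)]
    (hM : Even (Module.finrank ℝ EM)) (hB : Even (Module.finrank ℝ EB))
    (pr : C^∞⟮IM, M; IB, B⟯) (hsurj : Function.Surjective pr)
    (hpr : IsRiemannianSubmersion pr)
    {FM : Type*} [AddCommGroup FM] [Module (SmoothC IM M) FM]
    (SM : SpinorModule (vectorFieldMetric IM M) FM)
    {FB : Type*} [AddCommGroup FB] [Module (SmoothC IB B) FB]
    (SB : SpinorModule (vectorFieldMetric IB B) FB) :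
    letI := pullbackAlgebra pr
    haveI := pullback_starModule pr
    ∃ h : HermitianForm (SmoothC IM M) (VerticalSpinor hpr SB SM),
      IsVerticalHermitian hpr SB SM h.form ∧
      (∃ cV : verticalClifford (vectorFieldMetric IM M) (differential pr) ≃ₐ[SmoothC IM M]
            Module.End (SmoothC IM M) (VerticalSpinor hpr SB SM),
          (∀ X : LinearMap.ker (differential pr),
            cV (verticalι (vectorFieldMetric IM M) (differential pr) X) =
              verticalCliffordEnd hpr SB SM X) ∧
          (∀ a, cV (verticalInvolute a) =
            verticalGrading hpr SB SM * cV a * verticalGrading hpr SB SM) ∧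
          (∀ a s t, h.form (cV (verticalCstar (conj_mem_vertical pr) a) s) t =
            h.form s (cV a t))) ∧
      (∃ K : KOrientation pr (VerticalSpinor hpr SB SM),
          K.herm = h ∧ K.γ = verticalGrading hpr SB SM ∧
          ∀ X : LinearMap.ker (differential pr),
            K.c ((verticalMetric pr).ι X) = verticalCliffordEnd hpr SB SM X) := by
  let _ := pullbackAlgebra pr
  have := pullback_starModule pr
  exact exists_vertical_spinorModule hpr SB SM (differential_conj pr) (conj_mem_vertical pr)
    (nonneg_of_form_mul_nonneg pr hpr SB)
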